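/- Let $F:(M_1^n,g_1)\to(M_2^m,g_2)$ be a Riemannian submersion between smooth Riemannian manifolds, i.e. a surjective smooth map whose differential is surjective at every point and preserves the length of horizontal vectors. Fix $p\in M_1$, write $\mathcal V_p=\ker F_{*p}$, $\mathcal H_p=\mathcal V_p^{\perp}$, and assume $r=\dim\mathcal V_p>2$. Let $\nabla$ be the Levi-Civita connection of $g_1$, let $v,h$ be the orthogonal projections onto the vertical and horizontal distributions, let $\mathcal T_XY=h\nabla_{vX}vY+v\nabla_{vX}hY$ be O'Neill's tensor, and let $H=\frac1r\sum_{i=1}^r\mathcal T_{V_i}V_i$ be the mean curvature vector of the fibre, where $\{V_i\}$ is an orthonormal basis of $\mathcal V_p$. With $R(X,Y)Z=\nabla_X\nabla_YZ-\nabla_Y\nabla_XZ-\nabla_{[X,Y]}Z$ put $R^{M_1}(X,Y,Z,W)=g_1(R(X,Y)W,Z)$, and let $R^{\ker F_*}$ be the tensor formed in the same way on vertical fields from the connection $v\nabla$ of the fibres. This is O'Neill's sign convention, in which the Gauss equation for vertical vectors is $R^{M_1}(X,Y,Z,W)=R^{\ker F_*}(X,Y,Z,W)+g_1(\mathcal T_XW,\mathcal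 T_YZ)-g_1(\mathcal T_YW,\mathcal T_XZ)$; the number $R(u,w,w,u)$ for orthonormal $u,w$ is then the negative of the number $g_1(R(u,w)w,u)$. For $\bullet\in\{M_1,\ker F_*\}$ let $$\tau_{\mathcal V}^{\bullet}(p)=\tfrac12\sum_{i,j=1}^rR^{\bullet}(V_i,V_j,V_j,V_i),\qquad K_{\mathcal V}^{\bullet}(\Pi)=R^{\bullet}(V_1,V_2,V_2,V_1)$$ for a $2$-plane $\Pi\subset\mathcal V_p$ with orthonormal basis $\{V_1,V_2\}$, and $\hat\delta^{\mathcal V}(2)=\tau_{\mathcal V}^{\ker F_*}(p)-\sup_{\Pi}K_{\mathcal V}^{\ker F_*}(\Pi)$, the supremum being over all $2$-planes $\Pi\subset\mathcal V_p$. Then the suprema of $K_{\mathcal V}^{\ker F_*}$ and of $K_{\mathcal V}^{M_1}$ over these planes are finite, and $$\hat\delta^{\mathcal V}(2)\;\ge\;\tau_{\mathcal V}^{M_1}(p)-\sup_{\Pi}K_{\mathcal V}^{M_1}(\Pi)-\frac{r^2(r-2)}{2(r-1)}\|H\|^2 .$$ For orthonormal bases $\{V_1,\dots,V_r\}$ of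 $\mathcal V_p$ and $\{h_1,\dots,h_m\}$ of $\mathcal H_p$ put $\mathcal T_{ij}^{\ell}=g_1(\mathcal T_{V_i}V_j,h_\ell)$ and consider the conditions $$\begin{aligned} &\mathcal T_{1j}^{\ell}=\mathcal T_{2j}^{\ell}=0 &&(j>2,\ \text{all }\ell),\\ &\mathcal T_{ij}^{1}=0 &&(i\ne j,\ i,j>2),\\ &\mathcal T_{ij}^{\ell}=0 &&(i,j>2,\ \ell\ge2),\\ &\mathcal T_{11}^{\ell}+\mathcal T_{22}^{\ell}=0 &&(\ell\ge2),\\ &\mathcal T_{11}^{1}+\mathcal T_{22}^{1}=\mathcal T_{33}^{1}=\dots=\mathcal T_{rr}^{1}. \end{aligned}\tag{$*$}$$ Equality holds in the inequality if and only if there are orthonormal bases $\{V_i\}$ of $\mathcal V_p$ and $\{h_\ell\}$ of $\mathcal H_p$ such that $\Pi=\mathrm{span}\{V_1,V_2\}$ satisfies $K_{\mathcal V}^{M_1}(\Pi)=\sup K_{\mathcal V}^{M_1}$, the conditions $(*)$ hold, and $\mathcal T_{12}^{1}=\mathcal T_{21}^{1}=0$. Moreover, if equality holds, then every $2$-plane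 $\Pi\subset\mathcal V_p$ with $K_{\mathcal V}^{\ker F_*}(\Pi)=\sup K_{\mathcal V}^{\ker F_*}$ also satisfies $K_{\mathcal V}^{M_1}(\Pi)=\sup K_{\mathcal V}^{M_1}$, and $(*)$ holds for all orthonormal bases with $\mathrm{span}\{V_1,V_2\}=\Pi$ and $H\perp h_\ell$ for $\ell\ge2$. (If $m=0$ there are no indices $\ell$ and the conditions on the $\mathcal T_{ij}^\ell$ are empty.) -/

import Mathlib

open Bundle
open scoped Manifold ContDiff

noncomputable section

namespace RiemSubm

section Connection

variable {E : Type*} [NormedAddCommGroup E] [NormedSpace ℝ E] [FiniteDimensional ℝ E]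
  {H : Type*} [TopologicalSpace H] (I : ModelWithCorners ℝ E H)
  {M : Type*} [TopologicalSpace M] [ChartedSpace H M] [IsManifold I ∞ M]

instance instFiniteDimensionalTangentSpace (p : M) : FiniteDimensional ℝ (TangentSpace I p) :=
  inferInstanceAs (FiniteDimensional ℝ E)

/-- The extension of a tangent vector at `p` to a vector field (defined everywhere, smooth near
`p`): constant coefficients in the preferred chart at `p`. All tensors below are evaluated at `p`
by means of such extensions. -/
def ext {p : M} (v : TangentSpace I p) : Π x : M, TangentSpace I x :=
  FiberBundle.extend E v

variable [RiemannianBundle (fun x : M ↦ TangentSpace I x)]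

/-- Right-hand side of the Koszul formula: the number `g(∇_X Y, Z)` at `x`. -/
def koszul (X Y Z : Π x : M, TangentSpace I x) (x : M) : ℝ :=
  (mvfderiv I (fun y ↦ inner ℝ (Y y) (Z y)) x (X x)
    + mvfderiv I (fun y ↦ inner ℝ (X y) (Z y)) x (Y x)
    - mvfderiv I (fun y ↦ inner ℝ (X y) (Y y)) x (Z x)
    + inner ℝ (VectorField.mlieBracket I X Y x) (Z x)
    - inner ℝ (VectorField.mlieBracket I X Z x) (Y x)
    - inner ℝ (VectorField.mlieBracket I Y Z x) (X x)) / 2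

/-- The Levi-Civita connection `∇_X Y`: at `x` it is the tangent vector whose inner product with
each vector `z` is given by the Koszul formula. -/
def leviCivita (X Y : Π x : M, TangentSpace I x) (x : M) : TangentSpace I x :=
  ∑ i, koszul I X Y (ext I (stdOrthonormalBasis ℝ (TangentSpace I x) i)) x •
    stdOrthonormalBasis ℝ (TangentSpace I x) i

/-- The curvature operator `R(X, Y) Z = ∇_X ∇_Y Z - ∇_Y ∇_X Z - ∇_[X, Y] Z` of a connection. -/
def curvatureOp
    (D : (Π x : M, TangentSpace I x) → (Π x : M, TangentSpace I x) → Π x : M, TangentSpace I x)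
    (X Y Z : Π x : M, TangentSpace I x) (x : M) : TangentSpace I x :=
  D X (D Y Z) x - D Y (D X Z) x - D (VectorField.mlieBracket I X Y) Z x

/-- The curvature tensor of the Levi-Civita connection as a quadrilinear form,
`R(X, Y, Z, W) = g(R(X, Y) W, Z) = g(R(Z, W) Y, X)`. This is the sign convention in which
the Gauss equation of the fibres of a Riemannian submersion reads
`R(X, Y, Z, W) = R^ker(X, Y, Z, W) + g(T_X W, T_Y Z) - g(T_Y W, T_X Z)`, as in O'Neill's work;
in it, `R(u, w, w, u) = g(R(u, w) u, w)` is minus the number `g(R(u, w) w, u)`. -/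
def riemannTensor (p : M) (x y z w : TangentSpace I p) : ℝ :=
  inner ℝ (curvatureOp I (leviCivita I) (ext I x) (ext I y) (ext I w) p) z

end Connection

section Submersion

variable {E₁ : Type*} [NormedAddCommGroup E₁] [NormedSpace ℝ E₁] [FiniteDimensional ℝ E₁]
  {H₁ : Type*} [TopologicalSpace H₁] (I₁ : ModelWithCorners ℝ E₁ H₁)
  {M₁ : Type*} [TopologicalSpace M₁] [ChartedSpace H₁ M₁] [IsManifold I₁ ∞ M₁]
  [RiemannianBundle (fun x : M₁ ↦ TangentSpace I₁ x)]
  {E₂ : Type*} [NormedAddCommGroup E₂] [NormedSpace ℝ E₂]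
  {H₂ : Type*} [TopologicalSpace H₂] (I₂ : ModelWithCorners ℝ E₂ H₂)
  {M₂ : Type*} [TopologicalSpace M₂] [ChartedSpace H₂ M₂]

/-- The vertical space `V_p = ker F_*p`. -/
def vertical (F : M₁ → M₂) (p : M₁) : Submodule ℝ (TangentSpace I₁ p) :=
  LinearMap.ker (mfderiv I₁ I₂ F p).toLinearMap

/-- The horizontal space `H_p = (ker F_*p)ᗮ`. -/
def horizontal (F : M₁ → M₂) (p : M₁) : Submodule ℝ (TangentSpace I₁ p) :=
  (vertical I₁ I₂ F p)ᗮ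

/-- A Riemannian submersion: a surjective smooth map whose differential is surjective at every
point and preserves the length of horizontal vectors. -/
structure IsRiemannianSubmersion [RiemannianBundle (fun x : M₂ ↦ TangentSpace I₂ x)]
    (F : M₁ → M₂) : Prop where
  contMDiff : ContMDiff I₁ I₂ ∞ F
  surjective : Function.Surjective F
  mfderiv_surjective : ∀ p, Function.Surjective (mfderiv I₁ I₂ F p)
  norm_mfderiv : ∀ p, ∀ v ∈ horizontal I₁ I₂ F p, ‖mfderiv I₁ I₂ F p v‖ = ‖v‖

/-- The vertical part `vX` of a vector field `X`. -/
def vert (F : M₁ → M₂) (X : Π x : M₁, TangentSpace I₁ x) (x : M₁) : TangentSpace I₁ x :=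
  (vertical I₁ I₂ F x).starProjection (X x)

/-- The horizontal part `hX` of a vector field `X`. -/
def hor (F : M₁ → M₂) (X : Π x : M₁, TangentSpace I₁ x) (x : M₁) : TangentSpace I₁ x :=
  (horizontal I₁ I₂ F x).starProjection (X x)

/-- O'Neill's tensor `T_X Y = h ∇_{vX} vY + v ∇_{vX} hY` on vector fields. -/
def oneillTField (F : M₁ → M₂) (X Y : Π x : M₁, TangentSpace I₁ x) (x : M₁) :
    TangentSpace I₁ x :=
  hor I₁ I₂ F (leviCivita I₁ (vert I₁ I₂ F X) (vert I₁ I₂ F Y)) x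
    + vert I₁ I₂ F (leviCivita I₁ (vert I₁ I₂ F X) (hor I₁ I₂ F Y)) x

/-- O'Neill's tensor `T` at the point `p`. -/
def oneillT (F : M₁ → M₂) (p : M₁) (x y : TangentSpace I₁ p) : TangentSpace I₁ p :=
  oneillTField I₁ I₂ F (ext I₁ x) (ext I₁ y) p

/-- The connection `v ∇_X Y` induced on the vertical distribution. For vertical `X`, `Y` it
restricts on each fibre to the Levi-Civita connection of the induced metric. -/
def vertConnection (F : M₁ → M₂) (X Y : Π x : M₁, TangentSpace I₁ x) :
    Π x : M₁, TangentSpace I₁ x :=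
  vert I₁ I₂ F (leviCivita I₁ X Y)

/-- The curvature tensor `R^{ker F_*}` of the vertical distribution, that is, of the fibres, with
the same convention as `riemannTensor`. It is meant for vertical vectors, which are extended
to vertical vector fields. -/
def kerTensor (F : M₁ → M₂) (p : M₁) (x y z w : TangentSpace I₁ p) : ℝ :=
  inner ℝ (curvatureOp I₁ (vertConnection I₁ I₂ F) (vert I₁ I₂ F (ext I₁ x))
    (vert I₁ I₂ F (ext I₁ y)) (vert I₁ I₂ F (ext I₁ w)) p) z

/-- The mean curvature vector `H(p) = (1 / r) ∑ T(V_i, V_i)` of the fibre through `p`. -/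
def meanCurvature (F : M₁ → M₂) (p : M₁) : TangentSpace I₁ p :=
  (Module.finrank ℝ (vertical I₁ I₂ F p) : ℝ)⁻¹ •
    ∑ i, oneillT I₁ I₂ F p (stdOrthonormalBasis ℝ (vertical I₁ I₂ F p) i : TangentSpace I₁ p)
      (stdOrthonormalBasis ℝ (vertical I₁ I₂ F p) i : TangentSpace I₁ p)

/-- `τ_V(p) = (1 / 2) ∑ R(V_i, V_j, V_j, V_i)` for an orthonormal basis `V_i` of `V_p`, for a
quadrilinear form `R` on the tangent space at `p`. -/
def scalarVert (F : M₁ → M₂) (p : M₁)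
    (R : TangentSpace I₁ p → TangentSpace I₁ p → TangentSpace I₁ p → TangentSpace I₁ p → ℝ) : ℝ :=
  (∑ i, ∑ j, R (stdOrthonormalBasis ℝ (vertical I₁ I₂ F p) i : TangentSpace I₁ p)
    (stdOrthonormalBasis ℝ (vertical I₁ I₂ F p) j : TangentSpace I₁ p)
    (stdOrthonormalBasis ℝ (vertical I₁ I₂ F p) j : TangentSpace I₁ p)
    (stdOrthonormalBasis ℝ (vertical I₁ I₂ F p) i : TangentSpace I₁ p)) / 2

/-- The set of all `K_V(Π) = R(V₁, V₂, V₂, V₁)`, where `V₁, V₂` is an orthonormal basis of a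
`2`-plane `Π ⊆ V_p`. -/
def planeCurvatures (F : M₁ → M₂) (p : M₁)
    (R : TangentSpace I₁ p → TangentSpace I₁ p → TangentSpace I₁ p → TangentSpace I₁ p → ℝ) :
    Set ℝ :=
  {k | ∃ u ∈ vertical I₁ I₂ F p, ∃ w ∈ vertical I₁ I₂ F p,
    ‖u‖ = 1 ∧ ‖w‖ = 1 ∧ inner ℝ u w = 0 ∧ k = R u w w u}

/-- `sup K_V` over all `2`-planes `Π ⊆ V_p`. -/
def supPlane (F : M₁ → M₂) (p : M₁)
    (R : TangentSpace I₁ p → TangentSpace I₁ p → TangentSpace I₁ p → TangentSpace I₁ p → ℝ) : ℝ :=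
  sSup (planeCurvatures I₁ I₂ F p R)

/-- The vertical invariant `δ̂^V(2) = τ_V^{ker F_*}(p) - (sup K_V^{ker F_*})(p)`. -/
def deltaHat (F : M₁ → M₂) (p : M₁) : ℝ :=
  scalarVert I₁ I₂ F p (kerTensor I₁ I₂ F p) - supPlane I₁ I₂ F p (kerTensor I₁ I₂ F p)

/-- The components `T_ij^ℓ = g(T(V_i, V_j), h_ℓ)` in orthonormal bases of `V_p` and `H_p`. -/
def comp (F : M₁ → M₂) (p : M₁) {r s : ℕ}
    (V : OrthonormalBasis (Fin r) ℝ (vertical I₁ I₂ F p))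
    (h : OrthonormalBasis (Fin s) ℝ (horizontal I₁ I₂ F p)) (i j : Fin r) (l : Fin s) : ℝ :=
  inner ℝ (oneillT I₁ I₂ F p (V i : TangentSpace I₁ p) (V j : TangentSpace I₁ p))
    (h l : TangentSpace I₁ p)

/-- The equality conditions on the components `T_ij^ℓ`. Indices start at `0` here: the plane `Π` is
spanned by `V 0`, `V 1`, and the distinguished horizontal vector is `h 0`. -/
structure EqualityConditions (F : M₁ → M₂) (p : M₁) {r s : ℕ}
    (V : OrthonormalBasis (Fin r) ℝ (vertical I₁ I₂ F p))
    (h : OrthonormalBasis (Fin s) ℝ (horizontal I₁ I₂ F p)) : Prop where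
  mixed : ∀ i j l, i.val < 2 → 2 ≤ j.val → comp I₁ I₂ F p V h i j l = 0
  off_diag : ∀ i j l, 2 ≤ i.val → 2 ≤ j.val → i ≠ j → l.val = 0 →
    comp I₁ I₂ F p V h i j l = 0
  lower : ∀ i j l, 2 ≤ i.val → 2 ≤ j.val → 1 ≤ l.val → comp I₁ I₂ F p V h i j l = 0
  trace : ∀ i j l, i.val = 0 → j.val = 1 → 1 ≤ l.val →
    comp I₁ I₂ F p V h i i l + comp I₁ I₂ F p V h j j l = 0
  umbilic : ∀ i j k l, i.val = 0 → j.val = 1 → 2 ≤ k.val → l.val = 0 →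
    comp I₁ I₂ F p V h i i l + comp I₁ I₂ F p V h j j l = comp I₁ I₂ F p V h k k l

end Submersion

end RiemSubm

end

namespace RiemSubm

set_option linter.unusedSectionVars false

open Filter Topology VectorField

section Geometry

variable {E : Type*} [NormedAddCommGroup E] [NormedSpace ℝ E] [FiniteDimensional ℝ E]
  [CompleteSpace E]
  {H : Type*} [TopologicalSpace H] {I : ModelWithCorners ℝ E H}
  {M : Type*} [TopologicalSpace M] [ChartedSpace H M] [IsManifold I ∞ M]
  {p : M}

lemma ext_self (v : TangentSpace I p) : ext I v p = v := FiberBundle.extend_apply_self E v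

lemma ext_add_eventuallyEq (v w : TangentSpace I p) :
    ∀ᶠ x in 𝓝 p, ext I (v + w) x = (ext I v + ext I w) x := by
  set e := trivializationAt E (TangentSpace I : M → Type _) p
  have h := (e.linear ℝ (FiberBundle.mem_baseSet_trivializationAt' p)).map_add v w
  filter_upwards [e.open_baseSet.mem_nhds (FiberBundle.mem_baseSet_trivializationAt' p)] with x hx
  have := (e.symmₗ ℝ x).map_add (e ⟨p, v⟩).2 (e ⟨p, w⟩).2
  rw [e.coe_symmₗ hx] at this
  exact (congrArg (e.symm x) h).trans this

lemma ext_smul_eventuallyEq (c : ℝ) (v : TangentSpace I p) :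
    ∀ᶠ x in 𝓝 p, ext I (c • v) x = (c • ext I v) x := by
  set e := trivializationAt E (TangentSpace I : M → Type _) p
  have h := (e.linear ℝ (FiberBundle.mem_baseSet_trivializationAt' p)).map_smul c v
  filter_upwards [e.open_baseSet.mem_nhds (FiberBundle.mem_baseSet_trivializationAt' p)] with x hx
  have := (e.symmₗ ℝ x).map_smul c (e ⟨p, v⟩).2
  rw [e.coe_symmₗ hx] at this
  exact (congrArg (e.symm x) h).trans this

lemma contMDiffAt_ext (v : TangentSpace I p) : CMDiffAt ∞ (T% (ext I v)) p :=
  FiberBundle.contMDiffAt_extend I E v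

lemma mdifferentiableAt_ext (v : TangentSpace I p) : MDiffAt (T% (ext I v)) p :=
  FiberBundle.mdifferentiableAt_extend I E v

lemma contMDiffAt_mfderiv_apply {E' : Type*} [NormedAddCommGroup E'] [NormedSpace ℝ E']
    {H' : Type*} [TopologicalSpace H'] {I' : ModelWithCorners ℝ E' H'}
    {M' : Type*} [TopologicalSpace M'] [ChartedSpace H' M'] [IsManifold I' ∞ M']
    {f : M → M'} (hf : CMDiffAt ∞ f p) {X : Π x : M, TangentSpace I x}
    (hX : CMDiffAt ∞ (T% X) p) :
    CMDiffAt ∞ (fun x ↦ (⟨f x, mfderiv I I' f x (X x)⟩ : TangentBundle I' M')) p :=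
  ContMDiffAt.clm_apply_of_inCoordinates (b₁ := id) (b₂ := f) (v := X)
    (ϕ := fun x ↦ mfderiv I I' f x) (hf.mfderiv_const (m := ∞) (n := ∞) le_rfl) hX hf

lemma contMDiffAt_mvfderiv_apply {f : M → ℝ} (hf : CMDiffAt ∞ f p)
    {X : Π x : M, TangentSpace I x} (hX : CMDiffAt ∞ (T% X) p) :
    CMDiffAt ∞ (fun x ↦ mvfderiv I f x (X x)) p :=
  (contMDiff_snd_tangentBundle_modelSpace ℝ 𝓘(ℝ, ℝ) (n := ∞)).contMDiffAt.comp _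
    (contMDiffAt_mfderiv_apply hf hX)

lemma contMDiffAt_mlieBracket {X Y : Π x : M, TangentSpace I x} (hX : CMDiffAt ∞ (T% X) p)
    (hY : CMDiffAt ∞ (T% Y) p) : CMDiffAt ∞ (T% (mlieBracket I X Y)) p := by
  have : IsManifold I (minSmoothness ℝ 2) M := by
    rw [minSmoothness_of_isRCLikeNormedField]; infer_instance
  have : IsManifold I (((⊤ : ℕ∞) : WithTop ℕ∞) + 1) M := ‹IsManifold I ∞ M›
  refine ContMDiffAt.mlieBracket_vectorField (m := ⊤) (n := ⊤) hX hY ?_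
  rw [minSmoothness_of_isRCLikeNormedField]; exact le_rfl

/-- A vector field acts on functions by `[X, Y] f = X (Y f) - Y (X f)`. -/
lemma mvfderiv_mlieBracket {X Y : Π x : M, TangentSpace I x} (hX : CMDiffAt ∞ (T% X) p)
    (hY : CMDiffAt ∞ (T% Y) p) {f : M → ℝ} (hf : CMDiffAt ∞ f p) :
    mvfderiv I f p (mlieBracket I X Y p) =
      mvfderiv I (fun x ↦ mvfderiv I f x (Y x)) p (X p) -
        mvfderiv I (fun x ↦ mvfderiv I f x (X x)) p (Y p) := by
  rcases subsingleton_or_nontrivial (TangentSpace I p) with h | h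
  · rw [Subsingleton.elim (mlieBracket I X Y p) 0, Subsingleton.elim (X p) 0,
      Subsingleton.elim (Y p) 0]
    simp
  obtain ⟨z, hz⟩ := exists_ne (0 : TangentSpace I p)
  have : IsManifold I (minSmoothness ℝ 2) M := by
    rw [minSmoothness_of_isRCLikeNormedField]; infer_instance
  have : IsManifold I (minSmoothness ℝ 3) M := by
    rw [minSmoothness_of_isRCLikeNormedField]; infer_instance
  set Z := ext I z
  have hZ : CMDiffAt ∞ (T% Z) p := contMDiffAt_ext z
  have hfZ : CMDiffAt ∞ (T% (f • Z)) p := hf.smul_section hZ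
  have ho : (∞ : WithTop ℕ∞) ≠ 0 := by simp
  have ev {W : Π x : M, TangentSpace I x} :
      mlieBracket I W (f • Z) =ᶠ[𝓝 p]
        (fun x ↦ mvfderiv I f x (W x)) • Z + f • mlieBracket I W Z := by
    have h1 := (contMDiffAt_iff_contMDiffAt_nhds (n := 1) (by simp)).1 (hf.of_le (by simp))
    have h2 := (contMDiffAt_iff_contMDiffAt_nhds (n := 1) (by simp)).1 (hZ.of_le (by simp))
    filter_upwards [h1, h2] with x hx hx'
    exact mlieBracket_smul_right (hx.mdifferentiableAt (by simp)) (hx'.mdifferentiableAt (by simp))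
  have key {V W : Π x : M, TangentSpace I x} (hV : CMDiffAt ∞ (T% V) p)
      (hW : CMDiffAt ∞ (T% W) p) : mlieBracket I V (mlieBracket I W (f • Z)) p =
      (mvfderiv I (fun x ↦ mvfderiv I f x (W x)) p (V p) • z +
        mvfderiv I f p (W p) • mlieBracket I V Z p) +
      (mvfderiv I f p (V p) • mlieBracket I W Z p +
        f p • mlieBracket I V (mlieBracket I W Z) p) := by
    have hWf := contMDiffAt_mvfderiv_apply hf hW
    have hWZ := contMDiffAt_mlieBracket hW hZ
    refine (Filter.EventuallyEq.mlieBracket_vectorField_eq (V₁ := V)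
      (W₁ := mlieBracket I W (f • Z)) EventuallyEq.rfl ev).trans ?_
    rw [mlieBracket_add_right ((hWf.smul_section hZ).mdifferentiableAt ho)
        ((hf.smul_section hWZ).mdifferentiableAt ho),
      mlieBracket_smul_right (hWf.mdifferentiableAt ho) (hZ.mdifferentiableAt ho),
      mlieBracket_smul_right (hf.mdifferentiableAt ho) (hWZ.mdifferentiableAt ho)]
    simp only [Z, ext_self]
  have h2 : minSmoothness ℝ 2 ≤ ∞ := by
    rw [minSmoothness_of_isRCLikeNormedField]; exact ENat.LEInfty.out
  have J := leibniz_identity_mlieBracket_apply (𝕜 := ℝ) (I := I) (x := p) (U := X) (V := Y)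
    (W := f • Z) (hX.of_le h2) (hY.of_le h2) (hfZ.of_le h2)
  have J' := leibniz_identity_mlieBracket_apply (𝕜 := ℝ) (I := I) (x := p) (U := X) (V := Y)
    (W := Z) (hX.of_le h2) (hY.of_le h2) (hZ.of_le h2)
  rw [key hX hY, key hY hX, ev.eq_of_nhds] at J
  simp only [Pi.add_apply, Pi.smul_apply', J', Z, ext_self] at J
  have J2 : (mvfderiv I f p (mlieBracket I X Y p) -
      (mvfderiv I (fun x ↦ mvfderiv I f x (Y x)) p (X p) -
        mvfderiv I (fun x ↦ mvfderiv I f x (X x)) p (Y p))) • z = 0 := by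
    rw [← sub_eq_zero] at J
    rw [← neg_eq_zero, ← J]
    module
  exact sub_eq_zero.1 ((smul_eq_zero.1 J2).resolve_right hz)

variable [RiemannianBundle (fun x : M ↦ TangentSpace I x)]
  [IsContMDiffRiemannianBundle I ∞ E (fun x : M ↦ TangentSpace I x)]

lemma contMDiffAt_inner {X Y : Π x : M, TangentSpace I x} (hX : CMDiffAt ∞ (T% X) p)
    (hY : CMDiffAt ∞ (T% Y) p) : CMDiffAt ∞ (fun x ↦ inner ℝ (X x) (Y x)) p :=
  ContMDiffAt.inner_bundle (E := fun x : M ↦ TangentSpace I x) hX hY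

lemma mdifferentiableAt_inner {X Y : Π x : M, TangentSpace I x} (hX : MDiffAt (T% X) p)
    (hY : MDiffAt (T% Y) p) : MDiffAt (fun x ↦ inner ℝ (X x) (Y x)) p :=
  MDifferentiableAt.inner_bundle (E := fun x : M ↦ TangentSpace I x) hX hY

variable {X X' Y Y' Z : Π x : M, TangentSpace I x}

lemma mvfderiv_mul_apply {f g : M → ℝ} (hf : MDiffAt f p) (hg : MDiffAt g p)
    (v : TangentSpace I p) : mvfderiv I (fun x ↦ f x * g x) p v =
      f p * mvfderiv I g p v + g p * mvfderiv I f p v := by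
  rw [mvfderiv_fun_mul hf hg]; simp

lemma mvfderiv_add_apply {f g : M → ℝ} (hf : MDiffAt f p) (hg : MDiffAt g p)
    (v : TangentSpace I p) : mvfderiv I (fun x ↦ f x + g x) p v =
      mvfderiv I f p v + mvfderiv I g p v := by
  rw [mvfderiv_fun_add hf hg]; simp

lemma mvfderiv_congr {f g : M → ℝ} (h : f =ᶠ[𝓝 p] g) : mvfderiv I f p = mvfderiv I g p := by
  unfold mvfderiv
  rw [h.mfderiv_eq, h.eq_of_nhds]

lemma koszul_tensorialAt (hX : MDiffAt (T% X) p) (hY : MDiffAt (T% Y) p) :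
    TensorialAt I E (fun Z ↦ koszul I X Y Z p) p where
  smul {f Z} hf hZ := by
    simp only [koszul, Pi.smul_apply', inner_smul_right, mlieBracket_smul_right hf hZ,
      mvfderiv_mul_apply hf (mdifferentiableAt_inner hY hZ), smul_eq_mul,
      mvfderiv_mul_apply hf (mdifferentiableAt_inner hX hZ), map_smul, inner_add_left,
      inner_smul_left, conj_trivial]
    rw [real_inner_comm (Y p) (Z p), real_inner_comm (X p) (Z p)]
    ring
  add {Z Z'} hZ hZ' := by
    simp only [koszul, Pi.add_apply, inner_add_right, mlieBracket_add_right hZ hZ',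
      mvfderiv_add_apply (mdifferentiableAt_inner hY hZ) (mdifferentiableAt_inner hY hZ'),
      mvfderiv_add_apply (mdifferentiableAt_inner hX hZ) (mdifferentiableAt_inner hX hZ'),
      map_add, inner_add_left]
    ring

lemma inner_leviCivita (hX : MDiffAt (T% X) p) (hY : MDiffAt (T% Y) p)
    (hZ : MDiffAt (T% Z) p) : inner ℝ (leviCivita I X Y p) (Z p) = koszul I X Y Z p := by
  have hT := koszul_tensorialAt hX hY
  rw [← hT.mkHom_apply hZ]
  conv_rhs => rw [← (stdOrthonormalBasis ℝ (TangentSpace I p)).sum_repr' (Z p)]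
  simp only [leviCivita, sum_inner, map_sum, map_smul, inner_smul_left, conj_trivial, smul_eq_mul]
  exact Finset.sum_congr rfl fun i _ ↦ mul_comm _ _

lemma inner_leviCivita_ext (hX : MDiffAt (T% X) p) (hY : MDiffAt (T% Y) p)
    (z : TangentSpace I p) : inner ℝ (leviCivita I X Y p) z = koszul I X Y (ext I z) p := by
  rw [← inner_leviCivita hX hY (mdifferentiableAt_ext z), ext_self]

lemma leviCivita_add_right (hX : MDiffAt (T% X) p) (hY : MDiffAt (T% Y) p)
    (hY' : MDiffAt (T% Y') p) :
    leviCivita I X (Y + Y') p = leviCivita I X Y p + leviCivita I X Y' p := by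
  refine ext_inner_right ℝ fun z ↦ ?_
  have hz := mdifferentiableAt_ext z
  rw [inner_add_left, inner_leviCivita_ext hX (mdifferentiableAt_add_section hY hY'),
    inner_leviCivita_ext hX hY, inner_leviCivita_ext hX hY']
  simp only [koszul, Pi.add_apply, inner_add_right, inner_add_left, mlieBracket_add_right hY hY',
    mlieBracket_add_left hY hY',
    mvfderiv_add_apply (mdifferentiableAt_inner hY hz) (mdifferentiableAt_inner hY' hz),
    mvfderiv_add_apply (mdifferentiableAt_inner hX hY) (mdifferentiableAt_inner hX hY'), map_add]
  ring

lemma leviCivita_smul_right {f : M → ℝ} (hf : MDiffAt f p) (hX : MDiffAt (T% X) p)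
    (hY : MDiffAt (T% Y) p) :
    leviCivita I X (f • Y) p = mvfderiv I f p (X p) • Y p + f p • leviCivita I X Y p := by
  refine ext_inner_right ℝ fun z ↦ ?_
  have hz := mdifferentiableAt_ext z
  rw [inner_add_left, inner_smul_left, inner_smul_left,
    inner_leviCivita_ext hX (hf.smul_section hY), inner_leviCivita_ext hX hY]
  simp only [koszul, Pi.smul_apply', inner_smul_right, mlieBracket_smul_right hf hY,
      mlieBracket_smul_left hf hY, smul_eq_mul,
      mvfderiv_mul_apply hf (mdifferentiableAt_inner hY hz),
      mvfderiv_mul_apply hf (mdifferentiableAt_inner hX hY), map_smul, inner_add_left,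
      inner_smul_left, conj_trivial, ext_self]
  rw [real_inner_comm (X p) (Y p)]
  ring

lemma leviCivita_add_left (hX : MDiffAt (T% X) p) (hX' : MDiffAt (T% X') p)
    (hY : MDiffAt (T% Y) p) :
    leviCivita I (X + X') Y p = leviCivita I X Y p + leviCivita I X' Y p := by
  refine ext_inner_right ℝ fun z ↦ ?_
  have hz := mdifferentiableAt_ext z
  rw [inner_add_left, inner_leviCivita_ext (mdifferentiableAt_add_section hX hX') hY,
    inner_leviCivita_ext hX hY, inner_leviCivita_ext hX' hY]
  simp only [koszul, Pi.add_apply, inner_add_right, inner_add_left, mlieBracket_add_left hX hX',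
    mvfderiv_add_apply (mdifferentiableAt_inner hX hz) (mdifferentiableAt_inner hX' hz),
    mvfderiv_add_apply (mdifferentiableAt_inner hX hY) (mdifferentiableAt_inner hX' hY), map_add]
  ring

lemma leviCivita_smul_left {f : M → ℝ} (hf : MDiffAt f p) (hX : MDiffAt (T% X) p)
    (hY : MDiffAt (T% Y) p) :
    leviCivita I (f • X) Y p = f p • leviCivita I X Y p := by
  refine ext_inner_right ℝ fun z ↦ ?_
  have hz := mdifferentiableAt_ext z
  rw [inner_smul_left, inner_leviCivita_ext (hf.smul_section hX) hY, inner_leviCivita_ext hX hY]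
  simp only [koszul, Pi.smul_apply', inner_smul_right,
      mlieBracket_smul_left hf hX, smul_eq_mul,
      mvfderiv_mul_apply hf (mdifferentiableAt_inner hX hz),
      mvfderiv_mul_apply hf (mdifferentiableAt_inner hX hY), map_smul, inner_add_left,
      inner_smul_left, conj_trivial, ext_self]
  ring

lemma leviCivita_congr (hX : ∀ᶠ x in 𝓝 p, X x = X' x) (hY : ∀ᶠ x in 𝓝 p, Y x = Y' x) :
    leviCivita I X Y p = leviCivita I X' Y' p := by
  have h (W : Π x : M, TangentSpace I x) : koszul I X Y W p = koszul I X' Y' W p := by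
    have h1 : (fun y ↦ (inner ℝ (Y y) (W y) : ℝ)) =ᶠ[𝓝 p] fun y ↦ inner ℝ (Y' y) (W y) := by
      filter_upwards [hY] with y hy using by rw [hy]
    have h2 : (fun y ↦ (inner ℝ (X y) (W y) : ℝ)) =ᶠ[𝓝 p] fun y ↦ inner ℝ (X' y) (W y) := by
      filter_upwards [hX] with y hy using by rw [hy]
    have h3 : (fun y ↦ (inner ℝ (X y) (Y y) : ℝ)) =ᶠ[𝓝 p] fun y ↦ inner ℝ (X' y) (Y' y) := by
      filter_upwards [hX, hY] with y hy hy' using by rw [hy, hy']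
    have h4 : mlieBracket I X Y p = mlieBracket I X' Y' p :=
      Filter.EventuallyEq.mlieBracket_vectorField_eq hX hY
    have h5 : mlieBracket I X W p = mlieBracket I X' W p :=
      Filter.EventuallyEq.mlieBracket_vectorField_eq hX EventuallyEq.rfl
    have h6 : mlieBracket I Y W p = mlieBracket I Y' W p :=
      Filter.EventuallyEq.mlieBracket_vectorField_eq hY EventuallyEq.rfl
    simp only [koszul, mvfderiv_congr h1, mvfderiv_congr h2, mvfderiv_congr h3, h4, h5, h6,
      hX.self_of_nhds, hY.self_of_nhds]
  simp only [leviCivita, h]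

/-- The Levi-Civita connection is metric. -/
lemma mvfderiv_inner (hX : MDiffAt (T% X) p) (hY : MDiffAt (T% Y) p) (hZ : MDiffAt (T% Z) p) :
    mvfderiv I (fun x ↦ inner ℝ (Y x) (Z x)) p (X p) =
      inner ℝ (leviCivita I X Y p) (Z p) + inner ℝ (Y p) (leviCivita I X Z p) := by
  rw [real_inner_comm (leviCivita I X Z p) (Y p), inner_leviCivita hX hY hZ, inner_leviCivita hX hZ hY,
    koszul, koszul]
  simp only [real_inner_comm (Z _) (Y _)]
  rw [mlieBracket_swap_apply (V := Z) (W := Y)]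
  simp only [inner_neg_left]
  ring

/-- The Levi-Civita connection is torsion free. -/
lemma leviCivita_sub_swap (hX : MDiffAt (T% X) p) (hY : MDiffAt (T% Y) p) :
    leviCivita I X Y p - leviCivita I Y X p = mlieBracket I X Y p := by
  refine ext_inner_right ℝ fun z ↦ ?_
  rw [inner_sub_left, inner_leviCivita_ext hX hY, inner_leviCivita_ext hY hX, koszul, koszul,
    mlieBracket_swap_apply (V := Y) (W := X)]
  simp only [real_inner_comm (X _) (Y _), inner_neg_left, ext_self]
  ring

/-- The solution of a linear system with smooth coefficients and invertible matrix is smooth. -/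
lemma contMDiffAt_of_linear_system {ι : Type*} [Fintype ι] [DecidableEq ι] {G : ι → ι → M → ℝ}
    {b c : ι → M → ℝ} (hG : ∀ i j, CMDiffAt ∞ (G i j) p) (hb : ∀ i, CMDiffAt ∞ (b i) p)
    (hGp : ∀ v : ι → ℝ, (∀ i, ∑ j, G i j p * v j = 0) → v = 0)
    (hc : ∀ᶠ x in 𝓝 p, ∀ i, ∑ j, G i j x * c j x = b i x) (i : ι) : CMDiffAt ∞ (c i) p := by
  let B : ι → ι → ((ι → ℝ) →L[ℝ] (ι → ℝ)) := fun i j ↦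
    (ContinuousLinearMap.proj (R := ℝ) (φ := fun _ : ι ↦ ℝ) j).smulRight (Pi.single i 1)
  let A : M → ((ι → ℝ) →L[ℝ] (ι → ℝ)) := fun x ↦ ∑ i, ∑ j, G i j x • B i j
  have hA : CMDiffAt ∞ A p := by
    refine ContMDiffAt.sum fun i _ ↦ ContMDiffAt.sum fun j _ ↦ (hG i j).smul contMDiffAt_const
  have hAv (x : M) (v : ι → ℝ) (i : ι) : A x v i = ∑ j, G i j x * v j := by
    simp only [A, B, sum_apply, smul_apply,
      ContinuousLinearMap.smulRight_apply, ContinuousLinearMap.proj_apply, Finset.sum_apply,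
      Pi.smul_apply, smul_eq_mul, Pi.single_apply]
    simp
  have hu : IsUnit (A p) := by
    rw [ContinuousLinearMap.isUnit_iff_bijective]
    have hinj : Function.Injective (A p) := by
      refine (injective_iff_map_eq_zero (A p)).2 fun v hv ↦ hGp v fun i ↦ ?_
      rw [← hAv, hv]; rfl
    exact ⟨hinj, (LinearMap.injective_iff_surjective (f := (A p).toLinearMap)).1 hinj⟩
  have hinv : CMDiffAt ∞ (fun x ↦ Ring.inverse (A x)) p := by
    obtain ⟨u, hu⟩ := hu
    have : ContDiffAt ℝ ∞ Ring.inverse (A p) := hu ▸ contDiffAt_ringInverse ℝ u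
    exact this.contMDiffAt.comp p hA
  have hbv : ContMDiffAt I 𝓘(ℝ, ι → ℝ) ∞ (fun x ↦ (fun i ↦ b i x : ι → ℝ)) p :=
    contMDiffAt_pi_space.2 hb
  have hs : ContMDiffAt I 𝓘(ℝ, ι → ℝ) ∞ (fun x ↦ Ring.inverse (A x) (fun i ↦ b i x)) p :=
    hinv.clm_apply hbv
  have hunits : ∀ᶠ x in 𝓝 p, IsUnit (A x) :=
    hA.continuousAt.eventually (Units.isOpen.mem_nhds hu)
  refine (contMDiffAt_pi_space.1 hs i).congr_of_eventuallyEq ?_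
  filter_upwards [hc, hunits] with x hx hux
  have h1 : A x (fun j ↦ c j x) = fun i ↦ b i x := by
    funext i; rw [hAv, hx]
  have h2 := congrArg (fun T ↦ T (fun j ↦ c j x) i) (Ring.inverse_mul_cancel (A x) hux)
  simpa [h1] using h2.symm

/-- A vector field is smooth when its inner products with all smooth vector fields are. -/
lemma contMDiffAt_of_inner {W : Π x : M, TangentSpace I x}
    (hW : ∀ Z : Π x : M, TangentSpace I x, CMDiffAt ∞ (T% Z) p →
      CMDiffAt ∞ (fun x ↦ inner ℝ (W x) (Z x)) p) : CMDiffAt ∞ (T% W) p := by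
  classical
  set e := trivializationAt E (TangentSpace I : M → Type _) p
  have hp : p ∈ e.baseSet := FiberBundle.mem_baseSet_trivializationAt' p
  let b := Module.finBasis ℝ E
  have hs i : CMDiffAt ∞ (T% (e.localFrame b i)) p := contMDiffAt_localFrame_of_mem ∞ e b i hp
  refine (contMDiffAt_iff_localFrameCoeff b hp).2 fun i ↦ ?_
  refine contMDiffAt_of_linear_system
    (G := fun i j x ↦ inner ℝ (e.localFrame b j x) (e.localFrame b i x))
    (c := fun i ↦ LinearMap.piApply (e.localFrameCoeff I b i) W)
    (fun i j ↦ contMDiffAt_inner (hs j) (hs i)) (fun i ↦ hW _ (hs i)) ?_ ?_ i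
  · intro v hv
    have h0 : ∑ j, v j • e.localFrame b j p = 0 := by
      rw [← inner_self_eq_zero (𝕜 := ℝ)]
      rw [inner_sum]
      refine Finset.sum_eq_zero fun i _ ↦ ?_
      rw [inner_smul_right, sum_inner]
      simp only [inner_smul_left, conj_trivial]
      rw [Finset.sum_congr rfl fun j _ ↦ mul_comm _ _, hv i, mul_zero]
    simp only [e.localFrame_apply_of_mem_baseSet b hp] at h0
    funext i
    exact Fintype.linearIndependent_iff.1 (e.basisAt b hp).linearIndependent v h0 i
  · filter_upwards [e.open_baseSet.mem_nhds hp] with x hx i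
    conv_rhs => rw [e.eq_sum_localFrameCoeff_smul (I := I) (s := W) (b := b) hx]
    rw [sum_inner]
    simp only [inner_smul_left, conj_trivial, LinearMap.piApply_apply]
    exact Finset.sum_congr rfl fun j _ ↦ mul_comm _ _

lemma eventually_mdifferentiableAt (hX : CMDiffAt ∞ (T% X) p) :
    ∀ᶠ x in 𝓝 p, MDiffAt (T% X) x := by
  filter_upwards [(contMDiffAt_iff_contMDiffAt_nhds (n := 1) (by simp)).1 (hX.of_le (by simp))]
    with x hx using hx.mdifferentiableAt (by simp)

lemma _root_.ContMDiffAt.mdiff (hX : CMDiffAt ∞ (T% X) p) : MDiffAt (T% X) p :=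
  hX.mdifferentiableAt (by simp)

lemma contMDiffAt_koszul (hX : CMDiffAt ∞ (T% X) p) (hY : CMDiffAt ∞ (T% Y) p)
    (hZ : CMDiffAt ∞ (T% Z) p) : CMDiffAt ∞ (koszul I X Y Z) p := by
  have h1 := contMDiffAt_mvfderiv_apply (contMDiffAt_inner hY hZ) hX
  have h2 := contMDiffAt_mvfderiv_apply (contMDiffAt_inner hX hZ) hY
  have h3 := contMDiffAt_mvfderiv_apply (contMDiffAt_inner hX hY) hZ
  have h4 := contMDiffAt_inner (contMDiffAt_mlieBracket hX hY) hZ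
  have h5 := contMDiffAt_inner (contMDiffAt_mlieBracket hX hZ) hY
  have h6 := contMDiffAt_inner (contMDiffAt_mlieBracket hY hZ) hX
  exact (((((h1.add h2).sub h3).add h4).sub h5).sub h6).div_const 2

lemma contMDiffAt_leviCivita (hX : CMDiffAt ∞ (T% X) p) (hY : CMDiffAt ∞ (T% Y) p) :
    CMDiffAt ∞ (T% (leviCivita I X Y)) p := by
  refine contMDiffAt_of_inner fun Z hZ ↦ (contMDiffAt_koszul hX hY hZ).congr_of_eventuallyEq ?_
  filter_upwards [eventually_mdifferentiableAt hX, eventually_mdifferentiableAt hY,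
    eventually_mdifferentiableAt hZ] with x h1 h2 h3 using inner_leviCivita h1 h2 h3

omit [RiemannianBundle (fun x : M ↦ TangentSpace I x)]
  [IsContMDiffRiemannianBundle I ∞ E (fun x : M ↦ TangentSpace I x)] in
/-- An operation which is linear over smooth functions depends only on the value at the point. -/
lemma eq_of_smooth_tensorial {A : Type*} [AddCommGroup A] [Module ℝ A]
    {Φ : (Π x : M, TangentSpace I x) → A}
    (hsmul : ∀ {f : M → ℝ} {σ : Π x : M, TangentSpace I x}, CMDiffAt ∞ f p →
      CMDiffAt ∞ (T% σ) p → Φ (f • σ) = f p • Φ σ)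
    (hadd : ∀ {σ τ : Π x : M, TangentSpace I x}, CMDiffAt ∞ (T% σ) p → CMDiffAt ∞ (T% τ) p →
      Φ (σ + τ) = Φ σ + Φ τ)
    (hX : CMDiffAt ∞ (T% X) p) (hY : CMDiffAt ∞ (T% Y) p) (hXY : X p = Y p) : Φ X = Φ Y := by
  classical
  have hlocal {σ τ : Π x : M, TangentSpace I x} (hσ : CMDiffAt ∞ (T% σ) p)
      (hτ : CMDiffAt ∞ (T% τ) p) (h : ∀ᶠ x in 𝓝 p, σ x = τ x) : Φ σ = Φ τ := by
    let ψ : M → ℝ := fun x ↦ if σ x = τ x then 1 else 0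
    have hψp : ψ p = 1 := by simp [ψ, h.self_of_nhds]
    have hψ : CMDiffAt ∞ ψ p :=
      (contMDiffAt_const (c := (1 : ℝ))).congr_of_eventuallyEq
        (h.mono fun x hx ↦ by simp [ψ, hx])
    have heq : ψ • σ = ψ • τ := by
      funext x
      simp only [Pi.smul_apply', ψ]
      split_ifs with hx <;> simp [hx]
    rw [← one_smul ℝ (Φ σ), ← one_smul ℝ (Φ τ), ← hψp, ← hsmul hψ hσ, ← hsmul hψ hτ, heq]
  have hzero : Φ 0 = 0 := by
    have h0 : CMDiffAt ∞ (T% (0 : Π x : M, TangentSpace I x)) p :=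
      (Bundle.contMDiff_zeroSection ℝ (TangentSpace I : M → Type _)).contMDiffAt
    have := hsmul (f := fun _ ↦ 0) (σ := 0) contMDiffAt_const h0
    rwa [smul_zero, zero_smul] at this
  set e := trivializationAt E (TangentSpace I : M → Type _) p
  have hp : p ∈ e.baseSet := FiberBundle.mem_baseSet_trivializationAt' p
  let b := Module.finBasis ℝ E
  have hs i : CMDiffAt ∞ (T% (e.localFrame b i)) p := contMDiffAt_localFrame_of_mem ∞ e b i hp
  have hexp {σ : Π x : M, TangentSpace I x} (hσ : CMDiffAt ∞ (T% σ) p) :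
      Φ σ = ∑ i, e.localFrameCoeff I b i p (σ p) • Φ (e.localFrame b i) := by
    have hc i : CMDiffAt ∞ (LinearMap.piApply (e.localFrameCoeff I b i) σ) p :=
      contMDiffAt_localFrameCoeff b hp hσ i
    have hsm (s : Finset (Fin (Module.finrank ℝ E))) :
        CMDiffAt ∞ (T% (∑ i ∈ s, LinearMap.piApply (e.localFrameCoeff I b i) σ •
          e.localFrame b i)) p ∧
        Φ (∑ i ∈ s, LinearMap.piApply (e.localFrameCoeff I b i) σ • e.localFrame b i) =
          ∑ i ∈ s, e.localFrameCoeff I b i p (σ p) • Φ (e.localFrame b i) := by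
      induction s using Finset.induction_on with
      | empty =>
        simp only [Finset.sum_empty]
        exact ⟨(Bundle.contMDiff_zeroSection ℝ (TangentSpace I : M → Type _)).contMDiffAt, hzero⟩
      | insert a s ha ih =>
        simp only [Finset.sum_insert ha]
        refine ⟨((hc a).smul_section (hs a)).add_section ih.1, ?_⟩
        rw [hadd ((hc a).smul_section (hs a)) ih.1, hsmul (hc a) (hs a), ih.2]
        rfl
    rw [← (hsm Finset.univ).2]
    refine hlocal hσ (hsm Finset.univ).1 ?_
    filter_upwards [e.eventually_eq_localFrame_sum_coeff_smul (I := I) (s := σ) b hp] with x hx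
    simpa [Finset.sum_apply] using hx
  rw [hexp hX, hexp hY, hXY]

lemma curvatureOp_swap (hX : CMDiffAt ∞ (T% X) p) (hY : CMDiffAt ∞ (T% Y) p)
    (hZ : CMDiffAt ∞ (T% Z) p) : curvatureOp I (leviCivita I) X Y Z p =
      - curvatureOp I (leviCivita I) Y X Z p := by
  have h : mlieBracket I X Y = (fun _ : M ↦ (-1 : ℝ)) • mlieBracket I Y X := by
    funext x
    rw [mlieBracket_swap_apply]; simp
  rw [curvatureOp, curvatureOp, h, leviCivita_smul_left mdifferentiableAt_const
    (contMDiffAt_mlieBracket hY hX).mdiff hZ.mdiff]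
  module

lemma curvatureOp_smul_right {f : M → ℝ} (hf : CMDiffAt ∞ f p) (hX : CMDiffAt ∞ (T% X) p)
    (hY : CMDiffAt ∞ (T% Y) p) (hZ : CMDiffAt ∞ (T% Z) p) :
    curvatureOp I (leviCivita I) X Y (f • Z) p = f p • curvatureOp I (leviCivita I) X Y Z p := by
  have ho : (∞ : WithTop ℕ∞) ≠ 0 := by simp
  have key {V W : Π x : M, TangentSpace I x} (hV : CMDiffAt ∞ (T% V) p)
      (hW : CMDiffAt ∞ (T% W) p) : leviCivita I V (leviCivita I W (f • Z)) p =
      (mvfderiv I (fun x ↦ mvfderiv I f x (W x)) p (V p) • Z p +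
        mvfderiv I f p (W p) • leviCivita I V Z p) +
      (mvfderiv I f p (V p) • leviCivita I W Z p +
        f p • leviCivita I V (leviCivita I W Z) p) := by
    have ev : ∀ᶠ x in 𝓝 p, leviCivita I W (f • Z) x =
        ((fun x ↦ mvfderiv I f x (W x)) • Z + f • leviCivita I W Z) x := by
      filter_upwards [(contMDiffAt_iff_contMDiffAt_nhds (n := 1) (by simp)).1 (hf.of_le (by simp)),
        eventually_mdifferentiableAt hW, eventually_mdifferentiableAt hZ] with x h1 h2 h3
      exact leviCivita_smul_right (h1.mdifferentiableAt (by simp)) h2 h3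
    have hWf := contMDiffAt_mvfderiv_apply hf hW
    have hWZ := contMDiffAt_leviCivita hW hZ
    rw [leviCivita_congr (Eventually.of_forall fun _ ↦ rfl) ev,
      leviCivita_add_right hV.mdiff (hWf.smul_section hZ).mdiff (hf.smul_section hWZ).mdiff,
      leviCivita_smul_right (hWf.mdifferentiableAt ho) hV.mdiff hZ.mdiff,
      leviCivita_smul_right (hf.mdifferentiableAt ho) hV.mdiff hWZ.mdiff]
  rw [curvatureOp, curvatureOp, key hX hY, key hY hX,
    leviCivita_smul_right (hf.mdifferentiableAt ho) (contMDiffAt_mlieBracket hX hY).mdiff hZ.mdiff,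
    mvfderiv_mlieBracket hX hY hf]
  module

lemma curvatureOp_add_right (hX : CMDiffAt ∞ (T% X) p)
    (hY : CMDiffAt ∞ (T% Y) p) (hZ : CMDiffAt ∞ (T% Z) p) {Z' : Π x : M, TangentSpace I x}
    (hZ' : CMDiffAt ∞ (T% Z') p) :
    curvatureOp I (leviCivita I) X Y (Z + Z') p =
      curvatureOp I (leviCivita I) X Y Z p + curvatureOp I (leviCivita I) X Y Z' p := by
  have key {V W : Π x : M, TangentSpace I x} (hV : CMDiffAt ∞ (T% V) p)
      (hW : CMDiffAt ∞ (T% W) p) : leviCivita I V (leviCivita I W (Z + Z')) p =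
      leviCivita I V (leviCivita I W Z) p + leviCivita I V (leviCivita I W Z') p := by
    have ev : ∀ᶠ x in 𝓝 p, leviCivita I W (Z + Z') x =
        (leviCivita I W Z + leviCivita I W Z') x := by
      filter_upwards [eventually_mdifferentiableAt hW, eventually_mdifferentiableAt hZ,
        eventually_mdifferentiableAt hZ'] with x h1 h2 h3
      exact leviCivita_add_right h1 h2 h3
    rw [leviCivita_congr (Eventually.of_forall fun _ ↦ rfl) ev,
      leviCivita_add_right hV.mdiff (contMDiffAt_leviCivita hW hZ).mdiff
        (contMDiffAt_leviCivita hW hZ').mdiff]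
  rw [curvatureOp, curvatureOp, curvatureOp, key hX hY, key hY hX,
    leviCivita_add_right (contMDiffAt_mlieBracket hX hY).mdiff hZ.mdiff hZ'.mdiff]
  module

lemma curvatureOp_smul_left {f : M → ℝ} (hf : CMDiffAt ∞ f p) (hX : CMDiffAt ∞ (T% X) p)
    (hY : CMDiffAt ∞ (T% Y) p) (hZ : CMDiffAt ∞ (T% Z) p) :
    curvatureOp I (leviCivita I) (f • X) Y Z p = f p • curvatureOp I (leviCivita I) X Y Z p := by
  have ho : (∞ : WithTop ℕ∞) ≠ 0 := by simp
  have hf1 := (contMDiffAt_iff_contMDiffAt_nhds (n := 1) (by simp)).1 (hf.of_le (by simp))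
  have ev : ∀ᶠ x in 𝓝 p, leviCivita I (f • X) Z x = (f • leviCivita I X Z) x := by
    filter_upwards [hf1, eventually_mdifferentiableAt hX, eventually_mdifferentiableAt hZ]
      with x h1 h2 h3
    exact leviCivita_smul_left (h1.mdifferentiableAt (by simp)) h2 h3
  have ev' : ∀ᶠ x in 𝓝 p, mlieBracket I (f • X) Y x =
      ((fun x ↦ - mvfderiv I f x (Y x)) • X + f • mlieBracket I X Y) x := by
    filter_upwards [hf1, eventually_mdifferentiableAt hX] with x h1 h2
    exact mlieBracket_smul_left (h1.mdifferentiableAt (by simp)) h2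
  have hYf := (contMDiffAt_mvfderiv_apply hf hY).neg
  have hXY := contMDiffAt_mlieBracket hX hY
  have hXZ := contMDiffAt_leviCivita hX hZ
  rw [curvatureOp, curvatureOp, leviCivita_smul_left (hf.mdifferentiableAt ho) hX.mdiff
      (contMDiffAt_leviCivita hY hZ).mdiff,
    leviCivita_congr (Eventually.of_forall fun _ ↦ rfl) ev,
    leviCivita_smul_right (hf.mdifferentiableAt ho) hY.mdiff hXZ.mdiff,
    leviCivita_congr ev' (Eventually.of_forall fun _ ↦ rfl),
    leviCivita_add_left (hYf.smul_section hX).mdiff (hf.smul_section hXY).mdiff hZ.mdiff,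
    leviCivita_smul_left (hYf.mdifferentiableAt ho) hX.mdiff hZ.mdiff,
    leviCivita_smul_left (hf.mdifferentiableAt ho) hXY.mdiff hZ.mdiff]
  module

lemma curvatureOp_add_left (hX : CMDiffAt ∞ (T% X) p) (hX' : CMDiffAt ∞ (T% X') p)
    (hY : CMDiffAt ∞ (T% Y) p) (hZ : CMDiffAt ∞ (T% Z) p) :
    curvatureOp I (leviCivita I) (X + X') Y Z p =
      curvatureOp I (leviCivita I) X Y Z p + curvatureOp I (leviCivita I) X' Y Z p := by
  have ev : ∀ᶠ x in 𝓝 p, leviCivita I (X + X') Z x =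
      (leviCivita I X Z + leviCivita I X' Z) x := by
    filter_upwards [eventually_mdifferentiableAt hX', eventually_mdifferentiableAt hX,
      eventually_mdifferentiableAt hZ] with x h1 h2 h3
    exact leviCivita_add_left h2 h1 h3
  have ev' : ∀ᶠ x in 𝓝 p, mlieBracket I (X + X') Y x =
      (mlieBracket I X Y + mlieBracket I X' Y) x := by
    filter_upwards [eventually_mdifferentiableAt hX', eventually_mdifferentiableAt hX]
      with x h1 h2
    exact mlieBracket_add_left h2 h1
  rw [curvatureOp, curvatureOp, curvatureOp, leviCivita_add_left hX.mdiff hX'.mdiff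
      (contMDiffAt_leviCivita hY hZ).mdiff,
    leviCivita_congr (Eventually.of_forall fun _ ↦ rfl) ev,
    leviCivita_add_right hY.mdiff (contMDiffAt_leviCivita hX hZ).mdiff
      (contMDiffAt_leviCivita hX' hZ).mdiff,
    leviCivita_congr ev' (Eventually.of_forall fun _ ↦ rfl),
    leviCivita_add_left (contMDiffAt_mlieBracket hX hY).mdiff (contMDiffAt_mlieBracket hX' hY).mdiff
      hZ.mdiff]
  module

/-- The curvature operator at a point depends only on the values of the fields there. -/
lemma curvatureOp_eq {Z' : Π x : M, TangentSpace I x} (hX : CMDiffAt ∞ (T% X) p)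
    (hX' : CMDiffAt ∞ (T% X') p) (hY : CMDiffAt ∞ (T% Y) p) (hY' : CMDiffAt ∞ (T% Y') p)
    (hZ : CMDiffAt ∞ (T% Z) p) (hZ' : CMDiffAt ∞ (T% Z') p) (h1 : X p = X' p) (h2 : Y p = Y' p)
    (h3 : Z p = Z' p) : curvatureOp I (leviCivita I) X Y Z p =
      curvatureOp I (leviCivita I) X' Y' Z' p := by
  have e1 {W V V' : Π x : M, TangentSpace I x} (hV : CMDiffAt ∞ (T% V) p)
      (hV' : CMDiffAt ∞ (T% V') p) (hW : CMDiffAt ∞ (T% W) p) (h : V p = V' p) :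
      curvatureOp I (leviCivita I) V W Z p = curvatureOp I (leviCivita I) V' W Z p :=
    eq_of_smooth_tensorial (Φ := fun V ↦ curvatureOp I (leviCivita I) V W Z p)
      (fun hf hσ ↦ curvatureOp_smul_left hf hσ hW hZ)
      (fun hσ hτ ↦ curvatureOp_add_left hσ hτ hW hZ) hV hV' h
  rw [e1 hX hX' hY h1, curvatureOp_swap hX' hY hZ, e1 hY hY' hX' h2, ← curvatureOp_swap hX' hY' hZ]
  exact eq_of_smooth_tensorial (Φ := fun V ↦ curvatureOp I (leviCivita I) X' Y' V p)
      (fun hf hσ ↦ curvatureOp_smul_right hf hX' hY' hσ)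
      (fun hσ hτ ↦ curvatureOp_add_right hX' hY' hσ hτ) hZ hZ' h3

lemma inner_curvatureOp_self (hX : CMDiffAt ∞ (T% X) p) (hY : CMDiffAt ∞ (T% Y) p)
    (hZ : CMDiffAt ∞ (T% Z) p) : inner ℝ (curvatureOp I (leviCivita I) X Y Z p) (Z p) = 0 := by
  have ho : (∞ : WithTop ℕ∞) ≠ 0 := by simp
  have hZZ := contMDiffAt_inner hZ hZ
  have key {V W : Π x : M, TangentSpace I x} (hV : CMDiffAt ∞ (T% V) p)
      (hW : CMDiffAt ∞ (T% W) p) :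
      mvfderiv I (fun x ↦ mvfderiv I (fun x ↦ inner ℝ (Z x) (Z x)) x (W x)) p (V p) =
        2 * inner ℝ (leviCivita I V (leviCivita I W Z) p) (Z p) +
        2 * inner ℝ (leviCivita I V Z p) (leviCivita I W Z p) := by
    have ev : (fun x ↦ mvfderiv I (fun x ↦ (inner ℝ (Z x) (Z x) : ℝ)) x (W x)) =ᶠ[𝓝 p]
        fun x ↦ inner ℝ (leviCivita I W Z x) (Z x) + inner ℝ (leviCivita I W Z x) (Z x) := by
      filter_upwards [eventually_mdifferentiableAt hW, eventually_mdifferentiableAt hZ]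
        with x h1 h2
      rw [mvfderiv_inner h1 h2 h2, real_inner_comm (leviCivita I W Z x) (Z x)]
    have hWZ := contMDiffAt_leviCivita hW hZ
    have hd := (contMDiffAt_inner hWZ hZ).mdifferentiableAt ho
    rw [mvfderiv_congr ev, mvfderiv_add_apply hd hd, mvfderiv_inner hV.mdiff hWZ.mdiff hZ.mdiff,
      real_inner_comm (leviCivita I V Z p) (leviCivita I W Z p)]
    ring
  have h := mvfderiv_mlieBracket hX hY hZZ
  rw [key hX hY, key hY hX, mvfderiv_inner (contMDiffAt_mlieBracket hX hY).mdiff hZ.mdiff hZ.mdiff,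
    real_inner_comm (leviCivita I (mlieBracket I X Y) Z p) (Z p),
    real_inner_comm (leviCivita I X Z p) (leviCivita I Y Z p)] at h
  rw [curvatureOp, inner_sub_left, inner_sub_left]
  linarith

section RiemannTensor

variable (x x' y y' z z' w w' : TangentSpace I p) (c : ℝ)

lemma riemannTensor_add₁ :
    riemannTensor I p (x + x') y z w = riemannTensor I p x y z w + riemannTensor I p x' y z w := by
  rw [riemannTensor, riemannTensor, riemannTensor, ← inner_add_left, ← curvatureOp_add_left
    (contMDiffAt_ext x) (contMDiffAt_ext x') (contMDiffAt_ext y) (contMDiffAt_ext w)]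
  congr 1
  refine curvatureOp_eq (contMDiffAt_ext _) ((contMDiffAt_ext x).add_section (contMDiffAt_ext x'))
    (contMDiffAt_ext _) (contMDiffAt_ext _) (contMDiffAt_ext _) (contMDiffAt_ext _) ?_ rfl rfl
  simp only [Pi.add_apply, ext_self]

lemma riemannTensor_smul₁ :
    riemannTensor I p (c • x) y z w = c * riemannTensor I p x y z w := by
  rw [riemannTensor, riemannTensor, ← real_inner_smul_left,
    ← curvatureOp_smul_left (f := fun _ ↦ c) contMDiffAt_const
    (contMDiffAt_ext x) (contMDiffAt_ext y) (contMDiffAt_ext w)]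
  congr 1
  refine curvatureOp_eq (contMDiffAt_ext _) (contMDiffAt_const.smul_section (contMDiffAt_ext x))
    (contMDiffAt_ext _) (contMDiffAt_ext _) (contMDiffAt_ext _) (contMDiffAt_ext _) ?_ rfl rfl
  simp only [Pi.smul_apply', ext_self]

lemma riemannTensor_swap₁₂ : riemannTensor I p x y z w = - riemannTensor I p y x z w := by
  rw [riemannTensor, riemannTensor, curvatureOp_swap (contMDiffAt_ext x) (contMDiffAt_ext y)
    (contMDiffAt_ext w), inner_neg_left]

lemma riemannTensor_add₃ :
    riemannTensor I p x y (z + z') w = riemannTensor I p x y z w + riemannTensor I p x y z' w := by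
  simp only [riemannTensor, inner_add_right]

lemma riemannTensor_smul₃ : riemannTensor I p x y (c • z) w = c * riemannTensor I p x y z w := by
  simp only [riemannTensor, inner_smul_right]

lemma riemannTensor_add₄ :
    riemannTensor I p x y z (w + w') = riemannTensor I p x y z w + riemannTensor I p x y z w' := by
  rw [riemannTensor, riemannTensor, riemannTensor, ← inner_add_left, ← curvatureOp_add_right
    (contMDiffAt_ext x) (contMDiffAt_ext y) (contMDiffAt_ext w) (contMDiffAt_ext w')]
  congr 1
  refine curvatureOp_eq (contMDiffAt_ext _) (contMDiffAt_ext _) (contMDiffAt_ext _)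
    (contMDiffAt_ext _) (contMDiffAt_ext _)
    ((contMDiffAt_ext w).add_section (contMDiffAt_ext w')) rfl rfl ?_
  simp only [Pi.add_apply, ext_self]

lemma riemannTensor_self₃₄ : riemannTensor I p x y z z = 0 := by
  have := inner_curvatureOp_self (contMDiffAt_ext x) (contMDiffAt_ext y) (contMDiffAt_ext z)
  rwa [ext_self] at this

lemma riemannTensor_swap₃₄ : riemannTensor I p x y z w = - riemannTensor I p x y w z := by
  have h := riemannTensor_self₃₄ x y (z + w)
  rw [riemannTensor_add₃, riemannTensor_add₄, riemannTensor_add₄, riemannTensor_self₃₄,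
    riemannTensor_self₃₄] at h
  linarith

end RiemannTensor

variable {E₂ : Type*} [NormedAddCommGroup E₂] [NormedSpace ℝ E₂]
  {H₂ : Type*} [TopologicalSpace H₂] {I₂ : ModelWithCorners ℝ E₂ H₂}
  {M₂ : Type*} [TopologicalSpace M₂] [ChartedSpace H₂ M₂] [IsManifold I₂ ∞ M₂]
  [RiemannianBundle (fun x : M₂ ↦ TangentSpace I₂ x)]
  {F : M → M₂}

lemma vert_mem (X : Π x : M, TangentSpace I x) (x : M) :
    vert I I₂ F X x ∈ vertical I I₂ F x := Submodule.starProjection_apply_mem _ _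

lemma hor_mem (X : Π x : M, TangentSpace I x) (x : M) :
    hor I I₂ F X x ∈ horizontal I I₂ F x := Submodule.starProjection_apply_mem _ _

lemma vert_add_hor (X : Π x : M, TangentSpace I x) (x : M) :
    vert I I₂ F X x + hor I I₂ F X x = X x :=
  Submodule.starProjection_add_starProjection_orthogonal _

lemma inner_of_mem' {v h : TangentSpace I p} (hv : v ∈ vertical I I₂ F p)
    (hh : h ∈ horizontal I I₂ F p) : inner ℝ h v = 0 :=
  Submodule.inner_left_of_mem_orthogonal hv hh

lemma vert_eq_self {x : M} (h : X x ∈ vertical I I₂ F x) : vert I I₂ F X x = X x :=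
  Submodule.starProjection_eq_self_iff.2 h

lemma hor_eq_zero {x : M} (h : X x ∈ vertical I I₂ F x) : hor I I₂ F X x = 0 := by
  have := vert_add_hor (I₂ := I₂) (F := F) X x
  rwa [vert_eq_self h, add_eq_left] at this

lemma vert_eq_zero {x : M} (h : X x ∈ horizontal I I₂ F x) : vert I I₂ F X x = 0 :=
  (Submodule.starProjection_apply_eq_zero_iff _).2 h

lemma mfderiv_hor (X : Π x : M, TangentSpace I x) (x : M) :
    mfderiv I I₂ F x (hor I I₂ F X x) = mfderiv I I₂ F x (X x) := by
  have h : mfderiv I I₂ F x (vert I I₂ F X x) = 0 := vert_mem X x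
  conv_rhs => rw [← vert_add_hor (I₂ := I₂) (F := F) X x, map_add, h, zero_add]

namespace IsRiemannianSubmersion

variable (hF : IsRiemannianSubmersion I I₂ F)
include hF

lemma inner_mfderiv {x : M} {v w : TangentSpace I x} (hv : v ∈ horizontal I I₂ F x)
    (hw : w ∈ horizontal I I₂ F x) :
    inner ℝ (mfderiv I I₂ F x v) (mfderiv I I₂ F x w) = inner ℝ v w := by
  rw [real_inner_eq_norm_add_mul_self_sub_norm_mul_self_sub_norm_mul_self_div_two,
    real_inner_eq_norm_add_mul_self_sub_norm_mul_self_sub_norm_mul_self_div_two, ← map_add,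
    hF.norm_mfderiv x _ (add_mem hv hw), hF.norm_mfderiv x _ hv, hF.norm_mfderiv x _ hw]

lemma inner_hor (X Z : Π x : M, TangentSpace I x) (x : M) : inner ℝ (hor I I₂ F X x) (Z x) =
    inner ℝ (mfderiv I I₂ F x (X x)) (mfderiv I I₂ F x (Z x)) := by
  rw [← mfderiv_hor X, ← mfderiv_hor Z, hF.inner_mfderiv (hor_mem X x) (hor_mem Z x)]
  conv_lhs => rw [← vert_add_hor (I₂ := I₂) (F := F) Z x, inner_add_right,
    inner_of_mem' (vert_mem Z x) (hor_mem X x), zero_add]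

lemma contMDiffAt_hor [IsContMDiffRiemannianBundle I₂ ∞ E₂ (fun x : M₂ ↦ TangentSpace I₂ x)]
    (hX : CMDiffAt ∞ (T% X) p) : CMDiffAt ∞ (T% (hor I I₂ F X)) p := by
  refine contMDiffAt_of_inner fun Z hZ ↦ ?_
  simp only [hF.inner_hor]
  exact ContMDiffAt.inner_bundle (E := fun x : M₂ ↦ TangentSpace I₂ x) (b := F)
    (contMDiffAt_mfderiv_apply hF.contMDiff.contMDiffAt hX)
    (contMDiffAt_mfderiv_apply hF.contMDiff.contMDiffAt hZ)

lemma contMDiffAt_vert [IsContMDiffRiemannianBundle I₂ ∞ E₂ (fun x : M₂ ↦ TangentSpace I₂ x)]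
    (hX : CMDiffAt ∞ (T% X) p) : CMDiffAt ∞ (T% (vert I I₂ F X)) p := by
  have h : vert I I₂ F X = X - hor I I₂ F X := by
    funext x
    rw [Pi.sub_apply, eq_sub_iff_add_eq, vert_add_hor]
  rw [h]
  exact hX.sub_section (hF.contMDiffAt_hor hX)

/-- The vertical distribution is integrable. -/
lemma mlieBracket_mem_vertical (hX : CMDiffAt ∞ (T% X) p) (hY : CMDiffAt ∞ (T% Y) p)
    (hXv : ∀ x, X x ∈ vertical I I₂ F x) (hYv : ∀ x, Y x ∈ vertical I I₂ F x) :
    mlieBracket I X Y p ∈ vertical I I₂ F p := by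
  have hFp : CMDiffAt ∞ F p := hF.contMDiff.contMDiffAt
  have hch : ContMDiffAt I₂ 𝓘(ℝ, E₂) ∞ (extChartAt I₂ (F p)) (F p) := contMDiffAt_extChartAt
  have hinj : Function.Injective (mfderiv I₂ 𝓘(ℝ, E₂) (extChartAt I₂ (F p)) (F p)) :=
    (isInvertible_mfderiv_extChartAt (mem_extChartAt_source (F p))).injective
  change mfderiv I I₂ F p (mlieBracket I X Y p) = 0
  refine hinj ?_
  rw [map_zero]
  refine (SeparatingDual.eq_zero_iff_forall_dual_eq_zero (R := ℝ) (V := E₂) _).2 fun ℓ ↦ ?_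
  let g : M₂ → ℝ := fun y ↦ ℓ (extChartAt I₂ (F p) y)
  have hg : CMDiffAt ∞ g (F p) := ℓ.contMDiff.contMDiffAt.comp (F p) hch
  have hgF : CMDiffAt ∞ (g ∘ F) p := hg.comp p hFp
  have hg1 := (contMDiffAt_iff_contMDiffAt_nhds (n := 1) (by simp)).1 (hg.of_le (by simp))
  have hz {V : Π x : M, TangentSpace I x} (hV : ∀ x, V x ∈ vertical I I₂ F x) :
      (fun x ↦ mvfderiv I (g ∘ F) x (V x)) =ᶠ[𝓝 p] fun _ ↦ (0 : ℝ) := by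
    filter_upwards [hFp.continuousAt.eventually hg1] with x hx
    have h0 : mfderiv I I₂ F x (V x) = 0 := hV x
    rw [mvfderiv_comp_apply x (hx.mdifferentiableAt (by simp))
      (hF.contMDiff.contMDiffAt.mdifferentiableAt (by simp)), h0, map_zero]
  have h := mvfderiv_mlieBracket hX hY hgF
  rw [mvfderiv_congr (hz hXv), mvfderiv_congr (hz hYv), mvfderiv_const] at h
  rw [mvfderiv_comp_apply p (hg.mdifferentiableAt (by simp)) (hFp.mdifferentiableAt (by simp))] at h
  have hcomp : mfderiv I₂ 𝓘(ℝ, ℝ) g (F p) =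
      ℓ ∘L (mfderiv I₂ 𝓘(ℝ, E₂) (extChartAt I₂ (F p)) (F p)) := by
    have := mfderiv_comp (I' := 𝓘(ℝ, E₂)) (I'' := 𝓘(ℝ, ℝ)) (F p) (g := ℓ) (f := extChartAt I₂ (F p))
      ℓ.mdifferentiableAt (hch.mdifferentiableAt (by simp))
    rw [ContinuousLinearMap.mfderiv_eq] at this
    exact this
  have h2 : mfderiv I₂ 𝓘(ℝ, ℝ) g (F p) (mfderiv I I₂ F p (mlieBracket I X Y p)) = 0 := by
    simpa [mvfderiv] using h
  rw [hcomp] at h2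
  exact h2

variable [IsContMDiffRiemannianBundle I₂ ∞ E₂ (fun x : M₂ ↦ TangentSpace I₂ x)]

omit hF [IsContMDiffRiemannianBundle I₂ ∞ E₂ (fun x : M₂ ↦ TangentSpace I₂ x)] in
lemma inner_hor_left (x : M) (v : TangentSpace I x) :
    inner ℝ (hor I I₂ F X x) v =
      inner ℝ (hor I I₂ F X x) ((horizontal I I₂ F x).starProjection v) := by
  rw [hor, Submodule.inner_starProjection_left_eq_right,
    Submodule.inner_starProjection_left_eq_right,
    Submodule.starProjection_eq_self_iff.2 (Submodule.starProjection_apply_mem _ v)]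

lemma inner_leviCivita_hor (hX : CMDiffAt ∞ (T% X) p) (hY : CMDiffAt ∞ (T% Y) p)
    (hZ : CMDiffAt ∞ (T% Z) p) (hZv : ∀ x, Z x ∈ vertical I I₂ F x) :
    inner ℝ (leviCivita I X (hor I I₂ F Y) p) (Z p) =
      - inner ℝ (hor I I₂ F Y p) (leviCivita I X Z p) := by
  have h := mvfderiv_inner hX.mdiff (hF.contMDiffAt_hor hY).mdiff hZ.mdiff
  have h0 : (fun x ↦ (inner ℝ (hor I I₂ F Y x) (Z x) : ℝ)) = fun _ ↦ 0 :=
    funext fun x ↦ inner_of_mem' (hZv x) (hor_mem Y x)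
  rw [h0, mvfderiv_const] at h
  have h' : (0 : ℝ) = _ := h
  linarith

lemma contMDiffAt_vert_ext (u : TangentSpace I p) : CMDiffAt ∞ (T% (vert I I₂ F (ext I u))) p :=
  hF.contMDiffAt_vert (contMDiffAt_ext u)

omit hF [IsContMDiffRiemannianBundle I₂ ∞ E₂ (fun x : M₂ ↦ TangentSpace I₂ x)] in
lemma vert_ext_self {u : TangentSpace I p} (hu : u ∈ vertical I I₂ F p) :
    vert I I₂ F (ext I u) p = u := by
  rw [vert_eq_self (by rwa [ext_self]), ext_self]

lemma oneillT_eq (u : TangentSpace I p) {w : TangentSpace I p}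
    (hw : w ∈ vertical I I₂ F p) : oneillT I I₂ F p u w =
      hor I I₂ F (leviCivita I (vert I I₂ F (ext I u)) (vert I I₂ F (ext I w))) p := by
  rw [oneillT, oneillTField, add_eq_left]
  refine vert_eq_zero ((Submodule.mem_orthogonal' _ _).2 fun v hv ↦ ?_)
  have h := hF.inner_leviCivita_hor (hF.contMDiffAt_vert_ext u) (contMDiffAt_ext w)
    (hF.contMDiffAt_vert_ext v) (vert_mem _)
  rwa [vert_ext_self hv, hor_eq_zero (by rwa [ext_self]), inner_zero_left, neg_zero] at h

lemma oneillT_mem (u : TangentSpace I p) {w : TangentSpace I p}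
    (hw : w ∈ vertical I I₂ F p) : oneillT I I₂ F p u w ∈ horizontal I I₂ F p := by
  rw [hF.oneillT_eq u hw]; exact hor_mem _ _

lemma oneillT_comm {u w : TangentSpace I p} (hu : u ∈ vertical I I₂ F p)
    (hw : w ∈ vertical I I₂ F p) : oneillT I I₂ F p u w = oneillT I I₂ F p w u := by
  rw [hF.oneillT_eq u hw, hF.oneillT_eq w hu, ← sub_eq_zero, hor, hor, ← map_sub,
    leviCivita_sub_swap (hF.contMDiffAt_vert_ext u).mdiff (hF.contMDiffAt_vert_ext w).mdiff]
  exact hor_eq_zero (hF.mlieBracket_mem_vertical (hF.contMDiffAt_vert_ext u)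
    (hF.contMDiffAt_vert_ext w) (vert_mem _) (vert_mem _))

omit hF [IsContMDiffRiemannianBundle I₂ ∞ E₂ (fun x : M₂ ↦ TangentSpace I₂ x)] in
lemma vert_ext_add (u w : TangentSpace I p) : ∀ᶠ x in 𝓝 p, vert I I₂ F (ext I (u + w)) x =
    (vert I I₂ F (ext I u) + vert I I₂ F (ext I w)) x := by
  filter_upwards [ext_add_eventuallyEq u w] with x hx
  simp only [vert, hx, Pi.add_apply, map_add]

omit hF [IsContMDiffRiemannianBundle I₂ ∞ E₂ (fun x : M₂ ↦ TangentSpace I₂ x)] in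
lemma vert_ext_smul (c : ℝ) (u : TangentSpace I p) : ∀ᶠ x in 𝓝 p,
    vert I I₂ F (ext I (c • u)) x = ((fun _ : M ↦ c) • vert I I₂ F (ext I u)) x := by
  filter_upwards [ext_smul_eventuallyEq c u] with x hx
  simp only [vert, hx, Pi.smul_apply, Pi.smul_apply', map_smul]

lemma oneillT_add_left (u u' : TangentSpace I p) {w : TangentSpace I p}
    (hw : w ∈ vertical I I₂ F p) :
    oneillT I I₂ F p (u + u') w = oneillT I I₂ F p u w + oneillT I I₂ F p u' w := by
  rw [hF.oneillT_eq _ hw, hF.oneillT_eq u hw, hF.oneillT_eq u' hw, hor, hor, hor, ← map_add,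
    leviCivita_congr (vert_ext_add u u') (Eventually.of_forall fun _ ↦ rfl),
    leviCivita_add_left (hF.contMDiffAt_vert_ext u).mdiff (hF.contMDiffAt_vert_ext u').mdiff
      (hF.contMDiffAt_vert_ext w).mdiff]

lemma oneillT_smul_left (c : ℝ) (u : TangentSpace I p) {w : TangentSpace I p}
    (hw : w ∈ vertical I I₂ F p) :
    oneillT I I₂ F p (c • u) w = c • oneillT I I₂ F p u w := by
  rw [hF.oneillT_eq _ hw, hF.oneillT_eq u hw, hor, hor, ← map_smul,
    leviCivita_congr (vert_ext_smul c u) (Eventually.of_forall fun _ ↦ rfl),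
    leviCivita_smul_left mdifferentiableAt_const (hF.contMDiffAt_vert_ext u).mdiff
      (hF.contMDiffAt_vert_ext w).mdiff]

/-- The Gauss equation of the fibres, for sectional curvatures. -/
lemma gauss {u w : TangentSpace I p} (hu : u ∈ vertical I I₂ F p)
    (hw : w ∈ vertical I I₂ F p) :
    kerTensor I I₂ F p u w w u = riemannTensor I p u w w u -
      (inner ℝ (oneillT I I₂ F p u u) (oneillT I I₂ F p w w) -
        inner ℝ (oneillT I I₂ F p u w) (oneillT I I₂ F p u w)) := by
  have hU := hF.contMDiffAt_vert_ext u
  have hW := hF.contMDiffAt_vert_ext w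
  have hR : riemannTensor I p u w w u = inner ℝ (curvatureOp I (leviCivita I)
      (vert I I₂ F (ext I u)) (vert I I₂ F (ext I w)) (vert I I₂ F (ext I u)) p) w := by
    rw [riemannTensor, curvatureOp_eq (contMDiffAt_ext u) hU (contMDiffAt_ext w) hW
      (contMDiffAt_ext u) hU] <;> rw [ext_self, vert_ext_self ‹_›]
  have hv (Y : Π x : M, TangentSpace I x) : inner ℝ (vert I I₂ F Y p) w = inner ℝ (Y p) w := by
    conv_rhs => rw [← vert_add_hor (I₂ := I₂) (F := F) Y p, inner_add_left,
      inner_of_mem' hw (hor_mem Y p), add_zero]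
  have hD {V Y : Π x : M, TangentSpace I x} (hV : CMDiffAt ∞ (T% V) p)
      (hY : CMDiffAt ∞ (T% Y) p) : inner ℝ (vertConnection I I₂ F V (vert I I₂ F Y) p) w =
        inner ℝ (leviCivita I V Y p) w + inner ℝ (hor I I₂ F Y p)
          (hor I I₂ F (leviCivita I V (vert I I₂ F (ext I w))) p) := by
    have h1 := hF.inner_leviCivita_hor hV hY hW (vert_mem _)
    rw [vert_ext_self hw, inner_hor_left] at h1
    have h2 : Y = vert I I₂ F Y + hor I I₂ F Y := funext fun x ↦ (vert_add_hor Y x).symm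
    have h3 : leviCivita I V Y p = leviCivita I V (vert I I₂ F Y) p +
        leviCivita I V (hor I I₂ F Y) p := by
      conv_lhs => rw [h2]
      exact leviCivita_add_right hV.mdiff (hF.contMDiffAt_vert hY).mdiff
        (hF.contMDiffAt_hor hY).mdiff
    rw [vertConnection, hv, h3, inner_add_left, h1]
    simp only [hor, neg_add_cancel_right]
  have h1 := hD hU (contMDiffAt_leviCivita hW hU)
  have h2 := hD hW (contMDiffAt_leviCivita hU hU)
  rw [← hF.oneillT_eq w hu, ← hF.oneillT_eq u hw] at h1
  rw [← hF.oneillT_eq u hu, ← hF.oneillT_eq w hw] at h2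
  rw [hR, kerTensor, curvatureOp, curvatureOp, inner_sub_left, inner_sub_left, inner_sub_left,
    inner_sub_left]
  have h3 := hv (leviCivita I (mlieBracket I (vert I I₂ F (ext I u)) (vert I I₂ F (ext I w)))
    (vert I I₂ F (ext I u)))
  rw [hF.oneillT_comm hw hu] at h1
  simp only [vertConnection] at h1 h2 ⊢
  rw [h1, h2, h3]
  ring

lemma finrank_horizontal [FiniteDimensional ℝ E₂] (p : M) :
    Module.finrank ℝ (horizontal I I₂ F p) = Module.finrank ℝ E₂ := by
  have h1 := LinearMap.finrank_range_add_finrank_ker (mfderiv I I₂ F p).toLinearMap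
  have h2 := Submodule.finrank_add_finrank_orthogonal (vertical I I₂ F p)
  have h3 : LinearMap.range (mfderiv I I₂ F p).toLinearMap = ⊤ :=
    LinearMap.range_eq_top.2 (hF.mfderiv_surjective p)
  rw [h3, finrank_top] at h1
  change Module.finrank ℝ E₂ + Module.finrank ℝ (vertical I I₂ F p) = _ at h1
  change _ + Module.finrank ℝ (horizontal I I₂ F p) = _ at h2
  omega

end IsRiemannianSubmersion

end Geometry

section Algebra

variable {V W : Type*} [NormedAddCommGroup V] [InnerProductSpace ℝ V] [FiniteDimensional ℝ V]
  [NormedAddCommGroup W] [InnerProductSpace ℝ W] [FiniteDimensional ℝ W]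

/-- The trace of a bilinear map does not depend on the orthonormal basis. -/
lemma sum_bilin_orthonormalBasis {A ι κ : Type*} [AddCommGroup A] [Module ℝ A] [Fintype ι]
    [Fintype κ] (B : V →ₗ[ℝ] V →ₗ[ℝ] A) (b : OrthonormalBasis ι ℝ V)
    (b' : OrthonormalBasis κ ℝ V) : ∑ i, B (b i) (b i) = ∑ k, B (b' k) (b' k) := by
  classical
  calc ∑ i, B (b i) (b i)
      = ∑ i, ∑ k, ∑ l, (inner ℝ (b' k) (b i) * inner ℝ (b i) (b' l)) • B (b' k) (b' l) := by
        refine Finset.sum_congr rfl fun i _ ↦ ?_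
        conv_lhs => rw [← b'.sum_repr' (b i)]
        simp only [map_sum, map_smul, LinearMap.sum_apply, LinearMap.smul_apply, Finset.smul_sum,
          smul_smul]
        rw [Finset.sum_comm]
        refine Finset.sum_congr rfl fun k _ ↦ Finset.sum_congr rfl fun l _ ↦ ?_
        rw [real_inner_comm (b' l) (b i), mul_comm]
    _ = ∑ k, ∑ l, (inner ℝ (b' k) (b' l) : ℝ) • B (b' k) (b' l) := by
        rw [Finset.sum_comm]
        refine Finset.sum_congr rfl fun k _ ↦ ?_
        rw [Finset.sum_comm]
        refine Finset.sum_congr rfl fun l _ ↦ ?_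
        rw [← Finset.sum_smul, b.sum_inner_mul_inner]
    _ = ∑ k, B (b' k) (b' k) := by
        refine Finset.sum_congr rfl fun k _ ↦ ?_
        simp [OrthonormalBasis.inner_eq_ite]

lemma card_mul_sum_norm_sq_sub {N : ℕ} (x : Fin N → W) :
    N * ∑ i, ‖x i‖ ^ 2 - ‖∑ i, x i‖ ^ 2 = (∑ i, ∑ j, ‖x i - x j‖ ^ 2) / 2 := by
  have h1 : ‖∑ i, x i‖ ^ 2 = ∑ i, ∑ j, (inner ℝ (x i) (x j) : ℝ) := by
    rw [← real_inner_self_eq_norm_sq, sum_inner]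
    simp only [inner_sum]
  simp only [norm_sub_sq_real, Finset.sum_add_distrib, Finset.sum_sub_distrib, ← Finset.mul_sum,
    Finset.sum_const, Finset.card_univ, Fintype.card_fin, nsmul_eq_mul, h1]
  ring

lemma sum_fin_add_two {A : Type*} [AddCommMonoid A] {s : ℕ} (f : Fin (s + 2) → A) :
    ∑ i, f i = f ⟨0, by omega⟩ + (f ⟨1, by omega⟩ + ∑ k : Fin s, f k.succ.succ) := by
  rw [Fin.sum_univ_succ, Fin.sum_univ_succ]; rfl

variable {s : ℕ}

/-- The defect in Chen's inequality for the family `t i j` of vectors. -/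
noncomputable def chenDefect (t : Fin (s + 2) → Fin (s + 2) → W) : ℝ :=
  (∑ i, ∑ j, ‖t i j‖ ^ 2) / 2 - ‖t ⟨0, by omega⟩ ⟨1, by omega⟩‖ ^ 2
    + inner ℝ (t ⟨0, by omega⟩ ⟨0, by omega⟩) (t ⟨1, by omega⟩ ⟨1, by omega⟩)
    - ‖∑ i, t i i‖ ^ 2 / (2 * (s + 1))

/-- The equality case of Chen's inequality. -/
structure ChenEquality (t : Fin (s + 2) → Fin (s + 2) → W) : Prop where
  zero_left : ∀ k : Fin s, t ⟨0, by omega⟩ k.succ.succ = 0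
  one_left : ∀ k : Fin s, t ⟨1, by omega⟩ k.succ.succ = 0
  off_diag : ∀ k l : Fin s, k ≠ l → t k.succ.succ l.succ.succ = 0
  diag : ∀ k : Fin s, t ⟨0, by omega⟩ ⟨0, by omega⟩ + t ⟨1, by omega⟩ ⟨1, by omega⟩ =
    t k.succ.succ k.succ.succ

lemma chenDefect_eq {t : Fin (s + 2) → Fin (s + 2) → W} (ht : ∀ i j, t i j = t j i) :
    chenDefect t = ∑ k : Fin s, (‖t ⟨0, by omega⟩ k.succ.succ‖ ^ 2 +
        ‖t ⟨1, by omega⟩ k.succ.succ‖ ^ 2) +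
      (∑ k : Fin s, ∑ l : Fin s, if k = l then 0 else ‖t k.succ.succ l.succ.succ‖ ^ 2) / 2 +
      (∑ i : Fin (s + 1), ∑ j : Fin (s + 1),
        ‖(Fin.cons (t ⟨0, by omega⟩ ⟨0, by omega⟩ + t ⟨1, by omega⟩ ⟨1, by omega⟩)
          (fun k : Fin s ↦ t k.succ.succ k.succ.succ) : Fin (s + 1) → W) i -
          (Fin.cons (t ⟨0, by omega⟩ ⟨0, by omega⟩ + t ⟨1, by omega⟩ ⟨1, by omega⟩)
          (fun k : Fin s ↦ t k.succ.succ k.succ.succ) : Fin (s + 1) → W) j‖ ^ 2) /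
            (4 * (s + 1)) := by
  have hsplit : ∑ k : Fin s, ∑ l : Fin s, ‖t k.succ.succ l.succ.succ‖ ^ 2 =
      (∑ k : Fin s, ∑ l : Fin s, if k = l then 0 else ‖t k.succ.succ l.succ.succ‖ ^ 2) +
      ∑ k : Fin s, ‖t k.succ.succ k.succ.succ‖ ^ 2 := by
    rw [← Finset.sum_add_distrib]
    refine Finset.sum_congr rfl fun k _ ↦ ?_
    rw [← Finset.sum_erase_add _ _ (Finset.mem_univ k),
      ← Finset.sum_erase_add (a := k) _ (fun l ↦ if k = l then _ else _) (Finset.mem_univ k)]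
    simp only [if_true, add_zero]
    congr 1
    refine Finset.sum_congr rfl fun l hl ↦ ?_
    rw [if_neg (Finset.ne_of_mem_erase hl).symm]
  have hx := card_mul_sum_norm_sq_sub
    (Fin.cons (t ⟨0, by omega⟩ ⟨0, by omega⟩ + t ⟨1, by omega⟩ ⟨1, by omega⟩)
      (fun k : Fin s ↦ t k.succ.succ k.succ.succ) : Fin (s + 1) → W)
  rw [Fin.sum_univ_succ, Fin.sum_univ_succ (f := Fin.cons _ _)] at hx
  simp only [Fin.cons_zero, Fin.cons_succ, norm_add_sq_real (t _ _) (t _ _)] at hx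
  have hs : (0 : ℝ) < s + 1 := by positivity
  rw [chenDefect]
  simp only [sum_fin_add_two, Finset.sum_add_distrib, hsplit]
  rw [ht ⟨1, _⟩ ⟨0, _⟩]
  simp only [fun k : Fin s ↦ ht k.succ.succ ⟨0, by omega⟩, fun k : Fin s ↦ ht k.succ.succ ⟨1, by omega⟩]
  rw [← add_assoc (t ⟨0, _⟩ ⟨0, _⟩)]
  push_cast at hx
  have e : ∀ D : ℝ, D / (4 * (s + 1)) = (D / 2) / (2 * (s + 1)) := fun D ↦ by field_simp; ring
  rw [e, ← hx]
  field_simp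
  ring

lemma chenDefect_nonneg {t : Fin (s + 2) → Fin (s + 2) → W} (ht : ∀ i j, t i j = t j i) :
    0 ≤ chenDefect t := by
  rw [chenDefect_eq ht]
  have : 0 ≤ ∑ k : Fin s, ∑ l : Fin s, if k = l then 0 else ‖t k.succ.succ l.succ.succ‖ ^ 2 :=
    Finset.sum_nonneg fun k _ ↦ Finset.sum_nonneg fun l _ ↦ by split_ifs <;> positivity
  positivity

lemma chenDefect_eq_zero_iff {t : Fin (s + 2) → Fin (s + 2) → W} (ht : ∀ i j, t i j = t j i) :
    chenDefect t = 0 ↔ ChenEquality t := by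
  have hs : (0 : ℝ) < 4 * (s + 1) := by positivity
  rw [chenDefect_eq ht]
  set x : Fin (s + 1) → W :=
    Fin.cons (t ⟨0, by omega⟩ ⟨0, by omega⟩ + t ⟨1, by omega⟩ ⟨1, by omega⟩)
      (fun k : Fin s ↦ t k.succ.succ k.succ.succ) with hx
  have h1 : ∀ k ∈ (Finset.univ : Finset (Fin s)), 0 ≤ ‖t ⟨0, by omega⟩ k.succ.succ‖ ^ 2 +
        ‖t ⟨1, by omega⟩ k.succ.succ‖ ^ 2 := fun k _ ↦ by positivity
  have h2' (k : Fin s) : ∀ l ∈ (Finset.univ : Finset (Fin s)),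
      0 ≤ if k = l then 0 else ‖t k.succ.succ l.succ.succ‖ ^ 2 :=
    fun l _ ↦ by split_ifs <;> positivity
  have h2 : ∀ k ∈ (Finset.univ : Finset (Fin s)),
      0 ≤ ∑ l : Fin s, if k = l then 0 else ‖t k.succ.succ l.succ.succ‖ ^ 2 :=
    fun k _ ↦ Finset.sum_nonneg (h2' k)
  have h3 : ∀ i ∈ (Finset.univ : Finset (Fin (s + 1))), 0 ≤ ∑ j, ‖x i - x j‖ ^ 2 :=
    fun i _ ↦ by positivity
  constructor
  · intro h
    have n1 := Finset.sum_nonneg h1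
    have n2 := Finset.sum_nonneg h2
    have n3 := div_nonneg (Finset.sum_nonneg h3) hs.le
    have z1 := (Finset.sum_eq_zero_iff_of_nonneg h1).1 (by linarith)
    have z2 := (Finset.sum_eq_zero_iff_of_nonneg h2).1 (by linarith)
    have z3 := (Finset.sum_eq_zero_iff_of_nonneg h3).1
      ((div_eq_zero_iff.1 (by linarith : _ / _ = (0 : ℝ))).resolve_right hs.ne')
    refine ⟨fun k ↦ ?_, fun k ↦ ?_, fun k l hkl ↦ ?_, fun k ↦ ?_⟩
    · have := (add_eq_zero_iff_of_nonneg (by positivity) (by positivity)).1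
        (z1 k (Finset.mem_univ k))
      exact norm_eq_zero.1 (pow_eq_zero_iff two_ne_zero |>.1 this.1)
    · have := (add_eq_zero_iff_of_nonneg (by positivity) (by positivity)).1
        (z1 k (Finset.mem_univ k))
      exact norm_eq_zero.1 (pow_eq_zero_iff two_ne_zero |>.1 this.2)
    · have := (Finset.sum_eq_zero_iff_of_nonneg (h2' k)).1 (z2 k (Finset.mem_univ k)) l
        (Finset.mem_univ l)
      rw [if_neg hkl] at this
      exact norm_eq_zero.1 (pow_eq_zero_iff two_ne_zero |>.1 this)
    · have := (Finset.sum_eq_zero_iff_of_nonneg fun j _ ↦ by positivity).1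
        (z3 0 (Finset.mem_univ 0)) k.succ (Finset.mem_univ k.succ)
      exact sub_eq_zero.1 (norm_eq_zero.1 (pow_eq_zero_iff two_ne_zero |>.1 this))
  · intro h
    have hc (i : Fin (s + 1)) :
        x i = t ⟨0, by omega⟩ ⟨0, by omega⟩ + t ⟨1, by omega⟩ ⟨1, by omega⟩ := by
      refine Fin.cases rfl (fun k ↦ ?_) i
      exact (h.diag k).symm
    have z2 (k l : Fin s) : (if k = l then 0 else ‖t k.succ.succ l.succ.succ‖ ^ 2) = 0 := by
      split_ifs with hkl
      · rfl
      · rw [h.off_diag k l hkl]; simp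
    simp only [h.zero_left, h.one_left, hc, z2, sub_self, norm_zero]
    simp

end Algebra

section CurvatureLike

variable {V W : Type*} [NormedAddCommGroup V] [InnerProductSpace ℝ V] [FiniteDimensional ℝ V]
  [NormedAddCommGroup W] [InnerProductSpace ℝ W] [FiniteDimensional ℝ W]

/-- A quadrilinear form which is antisymmetric in the first two and in the last two arguments. -/
structure IsCurvatureLike (R : V → V → V → V → ℝ) : Prop where
  add₁ : ∀ x x' y z w, R (x + x') y z w = R x y z w + R x' y z w
  smul₁ : ∀ (c : ℝ) x y z w, R (c • x) y z w = c * R x y z w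
  add₃ : ∀ x y z z' w, R x y (z + z') w = R x y z w + R x y z' w
  smul₃ : ∀ (c : ℝ) x y z w, R x y (c • z) w = c * R x y z w
  swap₁₂ : ∀ x y z w, R x y z w = - R y x z w
  swap₃₄ : ∀ x y z w, R x y z w = - R x y w z

namespace IsCurvatureLike

variable {R S : V → V → V → V → ℝ} (hR : IsCurvatureLike R)
include hR

lemma sub (hS : IsCurvatureLike S) : IsCurvatureLike fun x y z w ↦ R x y z w - S x y z w where
  add₁ x x' y z w := by rw [hR.add₁, hS.add₁]; ring
  smul₁ c x y z w := by rw [hR.smul₁, hS.smul₁]; ring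
  add₃ x y z z' w := by rw [hR.add₃, hS.add₃]; ring
  smul₃ c x y z w := by rw [hR.smul₃, hS.smul₃]; ring
  swap₁₂ x y z w := by rw [hR.swap₁₂, hS.swap₁₂]; ring
  swap₃₄ x y z w := by rw [hR.swap₃₄, hS.swap₃₄]; ring

lemma sum₁ {ι : Type*} (s : Finset ι) (c : ι → ℝ) (x : ι → V) (y z w : V) :
    R (∑ i ∈ s, c i • x i) y z w = ∑ i ∈ s, c i * R (x i) y z w := by
  let L : V →ₗ[ℝ] ℝ :=
    { toFun := fun x ↦ R x y z w
      map_add' := fun x x' ↦ hR.add₁ x x' y z w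
      map_smul' := fun c x ↦ hR.smul₁ c x y z w }
  change L _ = ∑ i ∈ s, c i * L (x i)
  simp only [map_sum, map_smul, smul_eq_mul]

lemma sum₃ {ι : Type*} (s : Finset ι) (c : ι → ℝ) (x y : V) (z : ι → V) (w : V) :
    R x y (∑ i ∈ s, c i • z i) w = ∑ i ∈ s, c i * R x y (z i) w := by
  let L : V →ₗ[ℝ] ℝ :=
    { toFun := fun z ↦ R x y z w
      map_add' := fun z z' ↦ hR.add₃ x y z z' w
      map_smul' := fun c z ↦ hR.smul₃ c x y z w }
  change L _ = ∑ i ∈ s, c i * L (z i)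
  simp only [map_sum, map_smul, smul_eq_mul]

lemma continuous : Continuous fun q : V × V ↦ R q.1 q.2 q.2 q.1 := by
  let e := stdOrthonormalBasis ℝ V
  have h (u w : V) : R u w w u = ∑ i, inner ℝ (e i) u * -∑ j, inner ℝ (e j) w *
      ∑ k, inner ℝ (e k) w * -∑ l, inner ℝ (e l) u * R (e j) (e i) (e l) (e k) := by
    conv_lhs =>
      rw [← e.sum_repr' u, hR.sum₁]
      enter [2, i]
      rw [e.sum_repr' u, hR.swap₁₂]
      conv => enter [2, 1, 1]; rw [← e.sum_repr' w]
      rw [hR.sum₁]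
      enter [2, 1, 2, j]
      conv => enter [2, 3]; rw [← e.sum_repr' w]
      rw [hR.sum₃]
      enter [2, 2, k]
      rw [hR.swap₃₄]
      conv => enter [2, 1, 3]; rw [← e.sum_repr' u]
      rw [hR.sum₃]
  simp only [h]
  fun_prop

/-- The sectional curvature of the plane spanned by an orthonormal pair is invariant under
rotations of the pair. -/
lemma rotation (u w : V) {c d : ℝ} (h : c ^ 2 + d ^ 2 = 1) :
    R (c • u + d • w) (-d • u + c • w) (-d • u + c • w) (c • u + d • w) = R u w w u := by
  have h0 (x z w : V) : R x x z w = 0 := by have := hR.swap₁₂ x x z w; linarith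
  have h1 (z w' : V) : R (c • u + d • w) (-d • u + c • w) z w' = R u w z w' := by
    rw [hR.add₁, hR.smul₁, hR.smul₁, hR.swap₁₂ u, hR.swap₁₂ w, hR.add₁, hR.add₁, hR.smul₁,
      hR.smul₁, hR.smul₁, hR.smul₁, h0, h0, hR.swap₁₂ w u]
    linear_combination R u w z w' * h
  have h2 (x y z : V) : R x y z z = 0 := by have := hR.swap₃₄ x y z z; linarith
  rw [h1, hR.add₃, hR.smul₃, hR.smul₃, hR.swap₃₄ u w u, hR.swap₃₄ u w w, hR.add₃, hR.add₃,
    hR.smul₃, hR.smul₃, hR.smul₃, hR.smul₃, h2, h2, hR.swap₃₄ u w u w]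
  linear_combination R u w w u * h

end IsCurvatureLike

/-- The quadratic correction in the Gauss equation. -/
lemma isCurvatureLike_gauss (T : V →ₗ[ℝ] V →ₗ[ℝ] W) :
    IsCurvatureLike fun x y z w ↦
      (inner ℝ (T x w) (T y z) - inner ℝ (T x z) (T y w) : ℝ) where
  add₁ x x' y z w := by simp only [map_add, LinearMap.add_apply, inner_add_left]; ring
  smul₁ c x y z w := by simp only [map_smul, LinearMap.smul_apply, real_inner_smul_left]; ring
  add₃ x y z z' w := by simp only [map_add, inner_add_left, inner_add_right]; ring
  smul₃ c x y z w := by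
    simp only [map_smul, real_inner_smul_left, real_inner_smul_right]; ring
  swap₁₂ x y z w := by
    rw [real_inner_comm (T y z) (T x w), real_inner_comm (T y w) (T x z)]; ring
  swap₃₄ x y z w := by ring

/-- The values of `f` at orthonormal pairs. -/
def pairValues (f : V → V → ℝ) : Set ℝ :=
  {k | ∃ u w : V, ‖u‖ = 1 ∧ ‖w‖ = 1 ∧ inner ℝ u w = 0 ∧ k = f u w}

lemma exists_isGreatest_pairValues {f : V → V → ℝ} (hf : Continuous fun q : V × V ↦ f q.1 q.2)
    (hV : 2 ≤ Module.finrank ℝ V) : ∃ u w : V, ‖u‖ = 1 ∧ ‖w‖ = 1 ∧ inner ℝ u w = 0 ∧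
      IsGreatest (pairValues f) (f u w) := by
  let K : Set (V × V) := {q | ‖q.1‖ = 1 ∧ ‖q.2‖ = 1 ∧ inner ℝ q.1 q.2 = 0}
  have hK : IsCompact K := by
    refine ((isCompact_sphere (0 : V) 1).prod (isCompact_sphere (0 : V) 1)).of_isClosed_subset
      ?_ ?_
    · exact (isClosed_eq (by fun_prop) continuous_const).inter
        ((isClosed_eq (by fun_prop) continuous_const).inter
          (isClosed_eq (by fun_prop) continuous_const))
    · rintro ⟨u, w⟩ ⟨hu, hw, -⟩
      simpa using ⟨hu, hw⟩
  let e := stdOrthonormalBasis ℝ V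
  have hne : K.Nonempty := by
    refine ⟨(e ⟨0, by omega⟩, e ⟨1, by omega⟩), e.norm_eq_one _, e.norm_eq_one _, ?_⟩
    rw [e.inner_eq_ite]; simp
  obtain ⟨⟨u, w⟩, ⟨hu, hw, huw⟩, hmax⟩ := hK.exists_isMaxOn hne hf.continuousOn
  refine ⟨u, w, hu, hw, huw, ⟨u, w, hu, hw, huw, rfl⟩, ?_⟩
  rintro k ⟨u', w', hu', hw', huw', rfl⟩
  exact hmax (a := (u', w')) ⟨hu', hw', huw'⟩

variable {s m : ℕ}

lemma exists_orthonormalBasis_pair (hV : Module.finrank ℝ V = s + 2) {u w : V} (hu : ‖u‖ = 1)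
    (hw : ‖w‖ = 1) (huw : inner ℝ u w = 0) : ∃ b : OrthonormalBasis (Fin (s + 2)) ℝ V,
      b ⟨0, by omega⟩ = u ∧ b ⟨1, by omega⟩ = w := by
  let v : Fin (s + 2) → V := fun i ↦ if i.val = 0 then u else w
  have hv : Orthonormal ℝ (({⟨0, by omega⟩, ⟨1, by omega⟩} : Set (Fin (s + 2))).domRestrict v) := by
    rw [orthonormal_iff_ite]
    rintro ⟨i, rfl | rfl⟩ ⟨j, rfl | rfl⟩ <;>
      simp [v, hu, hw, huw, real_inner_comm u w, Set.domRestrict]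
  obtain ⟨b, hb⟩ := hv.exists_orthonormalBasis_extension_of_card_eq (by simpa using hV)
  exact ⟨b, by simpa [v] using hb ⟨0, by omega⟩ (by simp),
    by simpa [v] using hb ⟨1, by omega⟩ (by simp)⟩

lemma exists_orthonormalBasis_orthogonal (hW : Module.finrank ℝ W = m) (a : W) :
    ∃ h : OrthonormalBasis (Fin m) ℝ W, ∀ l : Fin m, 1 ≤ l.val → inner ℝ a (h l) = 0 := by
  rcases eq_or_ne a 0 with rfl | ha
  · exact ⟨(stdOrthonormalBasis ℝ W).reindex (finCongr hW), by simp⟩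
  have hm : 0 < m := hW ▸ Module.finrank_pos_iff_exists_ne_zero.2 ⟨a, ha⟩
  let v : Fin m → W := fun _ ↦ ‖a‖⁻¹ • a
  have hv : Orthonormal ℝ (({⟨0, hm⟩} : Set (Fin m)).domRestrict v) := by
    rw [orthonormal_iff_ite]
    rintro ⟨i, rfl⟩ ⟨j, rfl⟩
    have : ‖a‖ ≠ 0 := norm_ne_zero_iff.2 ha
    simp [v, Set.domRestrict, norm_smul, this]
  obtain ⟨h, hh⟩ := hv.exists_orthonormalBasis_extension_of_card_eq (by simpa using hW)
  refine ⟨h, fun l hl ↦ ?_⟩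
  have h0 : h ⟨0, hm⟩ = ‖a‖⁻¹ • a := hh _ rfl
  have h1 : a = ‖a‖ • h ⟨0, hm⟩ := by
    rw [h0, smul_smul, mul_inv_cancel₀ (norm_ne_zero_iff.2 ha), one_smul]
  rw [h1, real_inner_smul_left, h.inner_eq_ite, if_neg, mul_zero]
  rintro rfl
  simp at hl

/-- A symmetric bilinear form on a plane is diagonal in some orthonormal basis. -/
lemma exists_rotation_diagonal (B : V →ₗ[ℝ] V →ₗ[ℝ] ℝ) (hB : ∀ x y, B x y = B y x) (u w : V) :
    ∃ c d : ℝ, c ^ 2 + d ^ 2 = 1 ∧ B (c • u + d • w) (-d • u + c • w) = 0 := by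
  let f : ℝ → ℝ := fun θ ↦
    B (Real.cos θ • u + Real.sin θ • w) (-Real.sin θ • u + Real.cos θ • w)
  have hf : Continuous f := by
    simp only [f, map_add, map_smul, LinearMap.add_apply, LinearMap.smul_apply, smul_eq_mul]
    fun_prop
  have h0 : f 0 = B u w := by simp [f]
  have h1 : f (Real.pi / 2) = - B u w := by simp [f, hB w u]
  have : (0 : ℝ) ∈ f '' Set.uIcc 0 (Real.pi / 2) := by
    refine intermediate_value_uIcc hf.continuousOn ?_
    rw [h0, h1, Set.mem_uIcc]
    rcases le_total 0 (B u w) with h | h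
    · right; constructor <;> linarith
    · left; constructor <;> linarith
  obtain ⟨θ, -, hθ⟩ := this
  exact ⟨Real.cos θ, Real.sin θ, Real.cos_sq_add_sin_sq θ, hθ⟩

lemma orthonormal_rotation {u w : V} (hu : ‖u‖ = 1) (hw : ‖w‖ = 1) (huw : inner ℝ u w = 0)
    {c d : ℝ} (h : c ^ 2 + d ^ 2 = 1) : ‖c • u + d • w‖ = 1 ∧ ‖-d • u + c • w‖ = 1 ∧
      inner ℝ (c • u + d • w) (-d • u + c • w) = 0 := by
  have hwu : inner ℝ w u = 0 := by rw [real_inner_comm, huw]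
  have hn (a b : ℝ) (hab : a ^ 2 + b ^ 2 = 1) : ‖a • u + b • w‖ = 1 := by
    rw [← pow_left_inj₀ (norm_nonneg _) zero_le_one two_ne_zero, norm_add_sq_real,
      real_inner_smul_left, real_inner_smul_right, huw, norm_smul, norm_smul, hu, hw]
    simp [hab]
  refine ⟨hn c d h, hn (-d) c (by linarith [neg_sq d]), ?_⟩
  simp only [inner_add_left, inner_add_right, real_inner_smul_left, real_inner_smul_right, huw,
    hwu, real_inner_self_eq_norm_sq, hu, hw]
  ring

end CurvatureLike

section ChenInequality

variable {V W : Type*} [NormedAddCommGroup V] [InnerProductSpace ℝ V] [FiniteDimensional ℝ V]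
  [NormedAddCommGroup W] [InnerProductSpace ℝ W] [FiniteDimensional ℝ W] {s m : ℕ}

/-- The conditions of the equality case on the components `c i j l` of a second fundamental
form. -/
structure ComponentConditions {r : ℕ} (c : Fin r → Fin r → Fin m → ℝ) : Prop where
  mixed : ∀ i j l, i.val < 2 → 2 ≤ j.val → c i j l = 0
  off_diag : ∀ i j l, 2 ≤ i.val → 2 ≤ j.val → i ≠ j → l.val = 0 → c i j l = 0
  lower : ∀ i j l, 2 ≤ i.val → 2 ≤ j.val → 1 ≤ l.val → c i j l = 0
  trace : ∀ i j l, i.val = 0 → j.val = 1 → 1 ≤ l.val → c i i l + c j j l = 0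
  umbilic : ∀ i j k l, i.val = 0 → j.val = 1 → 2 ≤ k.val → l.val = 0 →
    c i i l + c j j l = c k k l

lemma ComponentConditions.chenEquality {t : Fin (s + 2) → Fin (s + 2) → W}
    {h : OrthonormalBasis (Fin m) ℝ W}
    (hc : ComponentConditions fun i j l ↦ inner ℝ (t i j) (h l)) : ChenEquality t := by
  have ext {x y : W} (hxy : ∀ l, inner ℝ x (h l) = inner ℝ y (h l)) : x = y := by
    refine h.repr.injective (PiLp.ext fun l ↦ ?_)
    rw [h.repr_apply_apply, h.repr_apply_apply, real_inner_comm, hxy, real_inner_comm]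
  have cases (l : Fin m) : l.val = 0 ∨ 1 ≤ l.val := by omega
  refine ⟨fun k ↦ ?_, fun k ↦ ?_, fun k l hkl ↦ ?_, fun k ↦ ?_⟩
  · exact ext fun l ↦ (hc.mixed _ _ l (by simp) (by simp)).trans (inner_zero_left _).symm
  · exact ext fun l ↦ (hc.mixed _ _ l (by simp) (by simp)).trans (inner_zero_left _).symm
  · refine ext fun q ↦ Eq.trans ?_ (inner_zero_left _).symm
    rcases cases q with hq | hq
    · exact hc.off_diag _ _ q (by simp) (by simp) (by simpa using hkl) hq
    · exact hc.lower _ _ q (by simp) (by simp) hq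
  · refine ext fun l ↦ ?_
    rw [inner_add_left]
    rcases cases l with hl | hl
    · exact hc.umbilic _ _ _ l rfl rfl (by simp) hl
    · exact (hc.trace _ _ l rfl rfl hl).trans (hc.lower _ _ l (by simp) (by simp) hl).symm

lemma ChenEquality.componentConditions {t : Fin (s + 2) → Fin (s + 2) → W} (ht : ChenEquality t)
    {h : OrthonormalBasis (Fin m) ℝ W}
    (hh : ∀ l : Fin m, 1 ≤ l.val → inner ℝ (∑ i, t i i) (h l) = 0) :
    ComponentConditions fun i j l ↦ inner ℝ (t i j) (h l) := by
  have hsucc (j : Fin (s + 2)) (hj : 2 ≤ j.val) : ∃ k : Fin s, j = k.succ.succ :=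
    ⟨⟨j.val - 2, by omega⟩, Fin.ext (by simp; omega)⟩
  have htr : ∑ i, t i i = (s + 1 : ℝ) • (t ⟨0, by omega⟩ ⟨0, by omega⟩ +
      t ⟨1, by omega⟩ ⟨1, by omega⟩) := by
    rw [sum_fin_add_two]
    simp only [← ht.diag, Finset.sum_const, Finset.card_univ, Fintype.card_fin,
      ← Nat.cast_smul_eq_nsmul ℝ]
    module
  have hz (l : Fin m) (hl : 1 ≤ l.val) : inner ℝ (t ⟨0, by omega⟩ ⟨0, by omega⟩ +
      t ⟨1, by omega⟩ ⟨1, by omega⟩) (h l) = 0 := by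
    have := hh l hl
    rw [htr, real_inner_smul_left] at this
    exact (mul_eq_zero.1 this).resolve_left (by positivity)
  refine ⟨fun i j l hi hj ↦ ?_, fun i j l hi hj hij hl ↦ ?_, fun i j l hi hj hl ↦ ?_,
    fun i j l hi hj hl ↦ ?_, fun i j k l hi hj hk hl ↦ ?_⟩
  · obtain ⟨k, rfl⟩ := hsucc j hj
    obtain h0 | h1 : i.val = 0 ∨ i.val = 1 := by omega
    · rw [show i = ⟨0, by omega⟩ from Fin.ext h0, ht.zero_left, inner_zero_left]
    · rw [show i = ⟨1, by omega⟩ from Fin.ext h1, ht.one_left, inner_zero_left]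
  · obtain ⟨k, rfl⟩ := hsucc i hi
    obtain ⟨k', rfl⟩ := hsucc j hj
    rw [ht.off_diag k k' (by rintro rfl; exact hij rfl), inner_zero_left]
  · obtain ⟨k, rfl⟩ := hsucc i hi
    obtain ⟨k', rfl⟩ := hsucc j hj
    rcases eq_or_ne k k' with rfl | hk
    · rw [← ht.diag, hz l hl]
    · rw [ht.off_diag k k' hk, inner_zero_left]
  · rw [← inner_add_left, show i = ⟨0, by omega⟩ from Fin.ext hi,
      show j = ⟨1, by omega⟩ from Fin.ext hj, hz l hl]
  · obtain ⟨k', rfl⟩ := hsucc k hk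
    rw [← inner_add_left, show i = ⟨0, by omega⟩ from Fin.ext hi,
      show j = ⟨1, by omega⟩ from Fin.ext hj, ht.diag]

/-- Half the sum of the values of `f` over pairs of basis vectors. -/
noncomputable def halfSum {κ : Type*} [Fintype κ] (e : OrthonormalBasis κ ℝ V)
    (f : V → V → ℝ) : ℝ := (∑ i, ∑ j, f (e i) (e j)) / 2

/-- Chen's inequality and its equality case for curvature-like tensors related by a Gauss
equation. -/
theorem chen_inequality {κ : Type*} [Fintype κ] (e : OrthonormalBasis κ ℝ V)
    (hV : Module.finrank ℝ V = s + 2) (hW : Module.finrank ℝ W = m)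
    (T : V →ₗ[ℝ] V →ₗ[ℝ] W) (hT : ∀ u w, T u w = T w u) {R : V → V → V → V → ℝ}
    (hR : IsCurvatureLike R) {K K' : V → V → ℝ} (hK : ∀ u w, K u w = R u w w u)
    (hK' : ∀ u w, K' u w = K u w - (inner ℝ (T u u) (T w w) - inner ℝ (T u w) (T u w)))
    {A : W} (hA : A = ((s + 2 : ℕ) : ℝ)⁻¹ • ∑ i, T (e i) (e i)) {δ ρ : ℝ}
    (hδ : δ = halfSum e K' - sSup (pairValues K'))
    (hρ : ρ = halfSum e K - sSup (pairValues K) -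
      ((s + 2 : ℕ) : ℝ) ^ 2 * (((s + 2 : ℕ) : ℝ) - 2) / (2 * (((s + 2 : ℕ) : ℝ) - 1)) * ‖A‖ ^ 2) :
    (pairValues K').Nonempty ∧ BddAbove (pairValues K') ∧
    (pairValues K).Nonempty ∧ BddAbove (pairValues K) ∧ ρ ≤ δ ∧
    (δ = ρ ↔ ∃ (b : OrthonormalBasis (Fin (s + 2)) ℝ V) (h : OrthonormalBasis (Fin m) ℝ W),
      K (b ⟨0, by omega⟩) (b ⟨1, by omega⟩) = sSup (pairValues K) ∧
      ComponentConditions (fun i j l ↦ inner ℝ (T (b i) (b j)) (h l)) ∧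
      ∀ l : Fin m, l.val = 0 →
        inner ℝ (T (b ⟨0, by omega⟩) (b ⟨1, by omega⟩)) (h l) = 0 ∧
        inner ℝ (T (b ⟨1, by omega⟩) (b ⟨0, by omega⟩)) (h l) = 0) ∧
    (δ = ρ → ∀ (b : OrthonormalBasis (Fin (s + 2)) ℝ V) (h : OrthonormalBasis (Fin m) ℝ W),
      K' (b ⟨0, by omega⟩) (b ⟨1, by omega⟩) = sSup (pairValues K') →
      (∀ l : Fin m, 1 ≤ l.val → inner ℝ A (h l) = 0) →
      K (b ⟨0, by omega⟩) (b ⟨1, by omega⟩) = sSup (pairValues K) ∧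
      ComponentConditions (fun i j l ↦ inner ℝ (T (b i) (b j)) (h l))) := by
  have hR' := hR.sub (isCurvatureLike_gauss T)
  have hKR' (u w : V) : K' u w = R u w w u -
      (inner ℝ (T u u) (T w w) - inner ℝ (T u w) (T w u)) := by
    rw [hK', hK, hT w u]
  have hcont : Continuous fun q : V × V ↦ K q.1 q.2 := by
    simpa only [hK] using hR.continuous
  have hcont' : Continuous fun q : V × V ↦ K' q.1 q.2 := by
    simpa only [hKR'] using hR'.continuous
  have h2 : 2 ≤ Module.finrank ℝ V := by omega
  obtain ⟨u₀, w₀, -, -, -, hmax⟩ := exists_isGreatest_pairValues hcont h2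
  obtain ⟨u, w, hu, hw, huw, hmax'⟩ := exists_isGreatest_pairValues hcont' h2
  have hval {f : V → V → ℝ} (b : OrthonormalBasis (Fin (s + 2)) ℝ V) :
      f (b ⟨0, Nat.succ_pos _⟩) (b ⟨1, Nat.succ_lt_succ (Nat.succ_pos _)⟩) ∈ pairValues f :=
    ⟨_, _, b.norm_eq_one _, b.norm_eq_one _, by rw [b.inner_eq_ite]; simp, rfl⟩
  have hle (b : OrthonormalBasis (Fin (s + 2)) ℝ V) :
      K (b ⟨0, Nat.succ_pos _⟩) (b ⟨1, Nat.succ_lt_succ (Nat.succ_pos _)⟩) ≤ sSup (pairValues K) :=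
    le_csSup hmax.bddAbove (hval b)
  have hle' (b : OrthonormalBasis (Fin (s + 2)) ℝ V) :
      K' (b ⟨0, Nat.succ_pos _⟩) (b ⟨1, Nat.succ_lt_succ (Nat.succ_pos _)⟩) ≤ sSup (pairValues K') :=
    le_csSup hmax'.bddAbove (hval b)
  have htr (b : OrthonormalBasis (Fin (s + 2)) ℝ V) :
      ∑ i, T (b i) (b i) = ((s + 2 : ℕ) : ℝ) • A := by
    rw [hA, smul_smul, mul_inv_cancel₀ (by positivity), one_smul]
    exact sum_bilin_orthonormalBasis T b e
  have hsq (b : OrthonormalBasis (Fin (s + 2)) ℝ V) :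
      ∑ i, ∑ j, ‖T (b i) (b j)‖ ^ 2 = ∑ i, ∑ j, ‖T (e i) (e j)‖ ^ 2 := by
    have h1 (x : V) : ∑ j, ‖T x (b j)‖ ^ 2 = ∑ j, ‖T x (e j)‖ ^ 2 := by
      simpa [real_inner_self_eq_norm_sq] using
        sum_bilin_orthonormalBasis ((innerₗ W).compl₁₂ (T x) (T x)) b e
    simp only [h1]
    rw [Finset.sum_comm, Finset.sum_comm (f := fun i j ↦ ‖T (e i) (e j)‖ ^ 2)]
    refine Finset.sum_congr rfl fun j _ ↦ ?_
    simp only [hT _ (e j), h1]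
  have hhalf : halfSum e K' = halfSum e K + (∑ i, ∑ j, ‖T (e i) (e j)‖ ^ 2) / 2 -
      ‖∑ i, T (e i) (e i)‖ ^ 2 / 2 := by
    have h1 : ‖∑ i, T (e i) (e i)‖ ^ 2 =
        ∑ i, ∑ j, (inner ℝ (T (e i) (e i)) (T (e j) (e j)) : ℝ) := by
      rw [← real_inner_self_eq_norm_sq, sum_inner]
      simp only [inner_sum]
    simp only [halfSum, hK', Finset.sum_sub_distrib, h1, real_inner_self_eq_norm_sq]
    ring
  have key (b : OrthonormalBasis (Fin (s + 2)) ℝ V) :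
      δ - ρ = chenDefect (fun i j ↦ T (b i) (b j)) +
        (K' (b ⟨0, Nat.succ_pos _⟩) (b ⟨1, Nat.succ_lt_succ (Nat.succ_pos _)⟩) - sSup (pairValues K')) +
        (sSup (pairValues K) - K (b ⟨0, Nat.succ_pos _⟩) (b ⟨1, Nat.succ_lt_succ (Nat.succ_pos _)⟩)) := by
    have hsum : ∑ i, T (e i) (e i) = ((s + 2 : ℕ) : ℝ) • A := by
      rw [← htr b]; exact sum_bilin_orthonormalBasis T e b
    rw [hδ, hρ, hhalf, hK' (b _), chenDefect, hsq b, htr b, hsum, norm_smul,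
      real_inner_self_eq_norm_sq, Real.norm_natCast]
    push_cast
    have : (s + 2 - 1 : ℝ) ≠ 0 := by
      have : (0 : ℝ) < s + 1 := by positivity
      linarith
    have : (s + 1 : ℝ) ≠ 0 := by positivity
    rw [show (s + 2 - 1 : ℝ) = s + 1 by ring]
    field_simp
    ring
  have hsymm (b : OrthonormalBasis (Fin (s + 2)) ℝ V) (i j : Fin (s + 2)) :
      T (b i) (b j) = T (b j) (b i) := hT _ _
  have hfirst (hδρ : δ = ρ) (b : OrthonormalBasis (Fin (s + 2)) ℝ V)
      (h : OrthonormalBasis (Fin m) ℝ W)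
      (hb : K' (b ⟨0, Nat.succ_pos _⟩) (b ⟨1, Nat.succ_lt_succ (Nat.succ_pos _)⟩) = sSup (pairValues K'))
      (hh : ∀ l : Fin m, 1 ≤ l.val → inner ℝ A (h l) = 0) :
      K (b ⟨0, Nat.succ_pos _⟩) (b ⟨1, Nat.succ_lt_succ (Nat.succ_pos _)⟩) = sSup (pairValues K) ∧
      ComponentConditions (fun i j l ↦ inner ℝ (T (b i) (b j)) (h l)) := by
    have h1 := key b
    have h2 := chenDefect_nonneg (hsymm b)
    have h3 := hle b
    refine ⟨by linarith, ?_⟩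
    refine ((chenDefect_eq_zero_iff (hsymm b)).1 (by linarith)).componentConditions fun l hl ↦ ?_
    rw [htr b, real_inner_smul_left, hh l hl, mul_zero]
  refine ⟨⟨_, hmax'.1⟩, hmax'.bddAbove, ⟨_, hmax.1⟩, hmax.bddAbove, ?_, ⟨fun hδρ ↦ ?_, ?_⟩, hfirst⟩
  · obtain ⟨b, hb0, hb1⟩ := exists_orthonormalBasis_pair hV hu hw huw
    have h1 := key b
    have h2 := chenDefect_nonneg (hsymm b)
    have h3 := hle b
    rw [hb0, hb1] at h1 h3
    rw [hmax'.csSup_eq] at h1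
    linarith
  · obtain ⟨h, hh⟩ := exists_orthonormalBasis_orthogonal hW A
    obtain ⟨c, d, hcd, hB⟩ : ∃ c d : ℝ, c ^ 2 + d ^ 2 = 1 ∧ ∀ l : Fin m, l.val = 0 →
        inner ℝ (T (c • u + d • w) (-d • u + c • w)) (h l) = 0 := by
      rcases Nat.eq_zero_or_pos m with rfl | hm
      · exact ⟨1, 0, by norm_num, fun l ↦ l.elim0⟩
      · obtain ⟨c, d, hcd, hB⟩ := exists_rotation_diagonal
          (T.compr₂ ((innerₗ W) (h ⟨0, hm⟩))) (fun x y ↦ by simp [hT x y]) u w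
        refine ⟨c, d, hcd, fun l hl ↦ ?_⟩
        rw [show l = ⟨0, hm⟩ from Fin.ext hl, real_inner_comm]
        exact hB
    obtain ⟨hu', hw', huw'⟩ := orthonormal_rotation hu hw huw hcd
    obtain ⟨b, hb0, hb1⟩ := exists_orthonormalBasis_pair hV hu' hw' huw'
    have hrot : K' (b ⟨0, Nat.succ_pos _⟩) (b ⟨1, Nat.succ_lt_succ (Nat.succ_pos _)⟩) = sSup (pairValues K') := by
      rw [hb0, hb1, hmax'.csSup_eq, hKR', hKR']
      exact hR'.rotation u w hcd
    obtain ⟨h1, h2⟩ := hfirst hδρ b h hrot hh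
    refine ⟨b, h, h1, h2, fun l hl ↦ ?_⟩
    rw [hT (b ⟨1, _⟩), and_self, hb0, hb1]
    exact hB l hl
  · rintro ⟨b, h, hb, hc, -⟩
    obtain ⟨b', hb0, hb1⟩ := exists_orthonormalBasis_pair hV hu hw huw
    have h1 := key b
    have h2 := (chenDefect_eq_zero_iff (hsymm b)).2 hc.chenEquality
    have h3 := hle' b
    have h1' := key b'
    have h2' := chenDefect_nonneg (hsymm b')
    have h3' := hle b'
    rw [hb0, hb1] at h1' h3'
    rw [hmax'.csSup_eq] at h1'
    rw [hmax'.csSup_eq] at h1 h3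
    linarith

end ChenInequality

section Fibres

variable {E : Type*} [NormedAddCommGroup E] [NormedSpace ℝ E] [FiniteDimensional ℝ E]
  [CompleteSpace E]
  {H : Type*} [TopologicalSpace H] {I : ModelWithCorners ℝ E H}
  {M : Type*} [TopologicalSpace M] [ChartedSpace H M] [IsManifold I ∞ M]
  {p : M}
variable [RiemannianBundle (fun x : M ↦ TangentSpace I x)]
  [IsContMDiffRiemannianBundle I ∞ E (fun x : M ↦ TangentSpace I x)]
  {X X' Y Y' Z : Π x : M, TangentSpace I x}
variable {E₂ : Type*} [NormedAddCommGroup E₂] [NormedSpace ℝ E₂]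
  {H₂ : Type*} [TopologicalSpace H₂] {I₂ : ModelWithCorners ℝ E₂ H₂}
  {M₂ : Type*} [TopologicalSpace M₂] [ChartedSpace H₂ M₂] [IsManifold I₂ ∞ M₂]
  [RiemannianBundle (fun x : M₂ ↦ TangentSpace I₂ x)]
  {F : M → M₂}

lemma isCurvatureLike_riemannTensor (U : Submodule ℝ (TangentSpace I p)) :
    IsCurvatureLike fun x y z w : U ↦ riemannTensor I p x y z w where
  add₁ _ _ _ _ _ := riemannTensor_add₁ _ _ _ _ _
  smul₁ _ _ _ _ _ := riemannTensor_smul₁ _ _ _ _ _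
  add₃ _ _ _ _ _ := riemannTensor_add₃ _ _ _ _ _
  smul₃ _ _ _ _ _ := riemannTensor_smul₃ _ _ _ _ _
  swap₁₂ _ _ _ _ := riemannTensor_swap₁₂ _ _ _ _
  swap₃₄ _ _ _ _ := riemannTensor_swap₃₄ _ _ _ _

lemma planeCurvatures_eq
    (R : TangentSpace I p → TangentSpace I p → TangentSpace I p → TangentSpace I p → ℝ) :
    planeCurvatures I I₂ F p R = pairValues fun u w : vertical I I₂ F p ↦ R u w w u := by
  ext k
  constructor
  · rintro ⟨u, hu, w, hw, h1, h2, h3, h4⟩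
    exact ⟨⟨u, hu⟩, ⟨w, hw⟩, h1, h2, h3, h4⟩
  · rintro ⟨u, w, h1, h2, h3, h4⟩
    exact ⟨u, u.2, w, w.2, h1, h2, h3, h4⟩

variable [IsContMDiffRiemannianBundle I₂ ∞ E₂ (fun x : M₂ ↦ TangentSpace I₂ x)]

/-- The second fundamental form of the fibre at `p`. -/
noncomputable def IsRiemannianSubmersion.secondFundamentalForm
    (hF : IsRiemannianSubmersion I I₂ F) (p : M) :
    vertical I I₂ F p →ₗ[ℝ] vertical I I₂ F p →ₗ[ℝ] horizontal I I₂ F p :=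
  LinearMap.mk₂ ℝ (fun u w ↦ ⟨oneillT I I₂ F p u w, hF.oneillT_mem _ w.2⟩)
    (fun u u' w ↦ Subtype.ext (hF.oneillT_add_left _ _ w.2))
    (fun c u w ↦ Subtype.ext (hF.oneillT_smul_left c _ w.2))
    (fun u w w' ↦ Subtype.ext (by
      simp only [Submodule.coe_add, hF.oneillT_comm u.2 w.2, hF.oneillT_comm u.2 w'.2,
        hF.oneillT_comm u.2 (add_mem w.2 w'.2), hF.oneillT_add_left _ _ u.2]))
    (fun c u w ↦ Subtype.ext (by
      simp only [Submodule.coe_smul, hF.oneillT_comm u.2 w.2,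
        hF.oneillT_comm u.2 (Submodule.smul_mem _ c w.2), hF.oneillT_smul_left c _ u.2]))

end Fibres

end RiemSubm

theorem mainTheorem2 {n m r : ℕ}
    {M₁ : Type*} [TopologicalSpace M₁] [T2Space M₁] [ChartedSpace (EuclideanSpace ℝ (Fin n)) M₁]
    [IsManifold (𝓡 n) ∞ M₁] [RiemannianBundle (fun x : M₁ ↦ TangentSpace (𝓡 n) x)]
    [IsContMDiffRiemannianBundle (𝓡 n) ∞ (EuclideanSpace ℝ (Fin n))
      (fun x : M₁ ↦ TangentSpace (𝓡 n) x)]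
    {M₂ : Type*} [TopologicalSpace M₂] [T2Space M₂] [ChartedSpace (EuclideanSpace ℝ (Fin m)) M₂]
    [IsManifold (𝓡 m) ∞ M₂] [RiemannianBundle (fun x : M₂ ↦ TangentSpace (𝓡 m) x)]
    [IsContMDiffRiemannianBundle (𝓡 m) ∞ (EuclideanSpace ℝ (Fin m))
      (fun x : M₂ ↦ TangentSpace (𝓡 m) x)]
    (F : M₁ → M₂) (hF : RiemSubm.IsRiemannianSubmersion (𝓡 n) (𝓡 m) F) (p : M₁)
    (hr : Module.finrank ℝ (RiemSubm.vertical (𝓡 n) (𝓡 m) F p) = r) (hr2 : 2 < r) :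
    -- both suprema are suprema of nonempty sets of reals which are bounded above
    (RiemSubm.planeCurvatures (𝓡 n) (𝓡 m) F p (RiemSubm.kerTensor (𝓡 n) (𝓡 m) F p)).Nonempty ∧
    BddAbove (RiemSubm.planeCurvatures (𝓡 n) (𝓡 m) F p
      (RiemSubm.kerTensor (𝓡 n) (𝓡 m) F p)) ∧
    (RiemSubm.planeCurvatures (𝓡 n) (𝓡 m) F p (RiemSubm.riemannTensor (𝓡 n) p)).Nonempty ∧
    BddAbove (RiemSubm.planeCurvatures (𝓡 n) (𝓡 m) F p (RiemSubm.riemannTensor (𝓡 n) p)) ∧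
    -- the inequality
    RiemSubm.deltaHat (𝓡 n) (𝓡 m) F p ≥
      RiemSubm.scalarVert (𝓡 n) (𝓡 m) F p (RiemSubm.riemannTensor (𝓡 n) p)
        - RiemSubm.supPlane (𝓡 n) (𝓡 m) F p (RiemSubm.riemannTensor (𝓡 n) p)
        - (r : ℝ) ^ 2 * ((r : ℝ) - 2) / (2 * ((r : ℝ) - 1))
          * ‖RiemSubm.meanCurvature (𝓡 n) (𝓡 m) F p‖ ^ 2 ∧
    -- the equality case
    (RiemSubm.deltaHat (𝓡 n) (𝓡 m) F p =
        RiemSubm.scalarVert (𝓡 n) (𝓡 m) F p (RiemSubm.riemannTensor (𝓡 n) p)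
          - RiemSubm.supPlane (𝓡 n) (𝓡 m) F p (RiemSubm.riemannTensor (𝓡 n) p)
          - (r : ℝ) ^ 2 * ((r : ℝ) - 2) / (2 * ((r : ℝ) - 1))
            * ‖RiemSubm.meanCurvature (𝓡 n) (𝓡 m) F p‖ ^ 2 ↔
      ∃ (V : OrthonormalBasis (Fin r) ℝ (RiemSubm.vertical (𝓡 n) (𝓡 m) F p))
        (h : OrthonormalBasis (Fin m) ℝ (RiemSubm.horizontal (𝓡 n) (𝓡 m) F p)),
        RiemSubm.riemannTensor (𝓡 n) p
            (V ⟨0, by omega⟩ : TangentSpace (𝓡 n) p) (V ⟨1, by omega⟩ : TangentSpace (𝓡 n) p)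
            (V ⟨1, by omega⟩ : TangentSpace (𝓡 n) p) (V ⟨0, by omega⟩ : TangentSpace (𝓡 n) p)
          = RiemSubm.supPlane (𝓡 n) (𝓡 m) F p (RiemSubm.riemannTensor (𝓡 n) p) ∧
        RiemSubm.EqualityConditions (𝓡 n) (𝓡 m) F p V h ∧
        ∀ l : Fin m, l.val = 0 →
          RiemSubm.comp (𝓡 n) (𝓡 m) F p V h ⟨0, by omega⟩ ⟨1, by omega⟩ l = 0 ∧
          RiemSubm.comp (𝓡 n) (𝓡 m) F p V h ⟨1, by omega⟩ ⟨0, by omega⟩ l = 0) ∧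
    -- in the equality case the conditions hold at every plane where `K^{ker F_*}` is largest,
    -- in all orthonormal bases with `H` in the direction of the first horizontal vector
    (RiemSubm.deltaHat (𝓡 n) (𝓡 m) F p =
        RiemSubm.scalarVert (𝓡 n) (𝓡 m) F p (RiemSubm.riemannTensor (𝓡 n) p)
          - RiemSubm.supPlane (𝓡 n) (𝓡 m) F p (RiemSubm.riemannTensor (𝓡 n) p)
          - (r : ℝ) ^ 2 * ((r : ℝ) - 2) / (2 * ((r : ℝ) - 1))
            * ‖RiemSubm.meanCurvature (𝓡 n) (𝓡 m) F p‖ ^ 2 →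
      ∀ (V : OrthonormalBasis (Fin r) ℝ (RiemSubm.vertical (𝓡 n) (𝓡 m) F p))
        (h : OrthonormalBasis (Fin m) ℝ (RiemSubm.horizontal (𝓡 n) (𝓡 m) F p)),
        RiemSubm.kerTensor (𝓡 n) (𝓡 m) F p
            (V ⟨0, by omega⟩ : TangentSpace (𝓡 n) p) (V ⟨1, by omega⟩ : TangentSpace (𝓡 n) p)
            (V ⟨1, by omega⟩ : TangentSpace (𝓡 n) p) (V ⟨0, by omega⟩ : TangentSpace (𝓡 n) p)
          = RiemSubm.supPlane (𝓡 n) (𝓡 m) F p (RiemSubm.kerTensor (𝓡 n) (𝓡 m) F p) →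
        (∀ l : Fin m, 1 ≤ l.val →
          inner ℝ (RiemSubm.meanCurvature (𝓡 n) (𝓡 m) F p) (h l : TangentSpace (𝓡 n) p) = 0) →
        RiemSubm.riemannTensor (𝓡 n) p
            (V ⟨0, by omega⟩ : TangentSpace (𝓡 n) p) (V ⟨1, by omega⟩ : TangentSpace (𝓡 n) p)
            (V ⟨1, by omega⟩ : TangentSpace (𝓡 n) p) (V ⟨0, by omega⟩ : TangentSpace (𝓡 n) p)
          = RiemSubm.supPlane (𝓡 n) (𝓡 m) F p (RiemSubm.riemannTensor (𝓡 n) p) ∧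
        RiemSubm.EqualityConditions (𝓡 n) (𝓡 m) F p V h) := by
  obtain ⟨s, rfl⟩ : ∃ s, r = s + 2 := ⟨r - 2, by omega⟩
  have hm : Module.finrank ℝ (RiemSubm.horizontal (𝓡 n) (𝓡 m) F p) = m := by
    rw [hF.finrank_horizontal, finrank_euclideanSpace_fin]
  have hH : RiemSubm.meanCurvature (𝓡 n) (𝓡 m) F p = ((((s + 2 : ℕ) : ℝ)⁻¹ •
      ∑ i, hF.secondFundamentalForm p (stdOrthonormalBasis ℝ (RiemSubm.vertical (𝓡 n) (𝓡 m) F p) i)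
        (stdOrthonormalBasis ℝ (RiemSubm.vertical (𝓡 n) (𝓡 m) F p) i) :
          RiemSubm.horizontal (𝓡 n) (𝓡 m) F p) : TangentSpace (𝓡 n) p) := by
    rw [RiemSubm.meanCurvature, Submodule.coe_smul, Submodule.coe_sum]
    exact congrArg (fun k : ℕ ↦ (k : ℝ)⁻¹ • _) hr
  have key := RiemSubm.chen_inequality (stdOrthonormalBasis ℝ (RiemSubm.vertical (𝓡 n) (𝓡 m) F p))
    hr hm
    (hF.secondFundamentalForm p)
    (fun u w ↦ Subtype.ext (hF.oneillT_comm u.2 w.2))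
    (RiemSubm.isCurvatureLike_riemannTensor (RiemSubm.vertical (𝓡 n) (𝓡 m) F p))
    (K := fun u w ↦ RiemSubm.riemannTensor (𝓡 n) p u w w u)
    (K' := fun u w ↦ RiemSubm.kerTensor (𝓡 n) (𝓡 m) F p u w w u)
    (fun _ _ ↦ rfl) (fun u w ↦ hF.gauss u.2 w.2) rfl rfl rfl
  simp only [RiemSubm.deltaHat, RiemSubm.supPlane, RiemSubm.planeCurvatures_eq, hH, ge_iff_le]
  obtain ⟨h1, h2, h3, h4, h5, h6, h7⟩ := key
  refine ⟨h1, h2, h3, h4, h5, h6.trans ?_, fun heq V h hV hh ↦ ?_⟩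
  · constructor
    · rintro ⟨b, h, hb, hc, hl⟩
      exact ⟨b, h, hb, ⟨hc.mixed, hc.off_diag, hc.lower, hc.trace, hc.umbilic⟩, hl⟩
    · rintro ⟨b, h, hb, hc, hl⟩
      exact ⟨b, h, hb, ⟨hc.mixed, hc.off_diag, hc.lower, hc.trace, hc.umbilic⟩, hl⟩
  · obtain ⟨hb, hc⟩ := h7 heq V h hV hh
    exact ⟨hb, hc.mixed, hc.off_diag, hc.lower, hc.trace, hc.umbilic⟩
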